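/- **Conventions.** Let $k$ be a commutative artinian ring, let $I$ be a minimal injective cogenerator of $k$ (an injective envelope of the direct sum of one copy of each simple $k$-module), and put $D=\operatorname{Hom}_k(-,I)$. Let $n\ge 1$ and let $(\mathcal C,\mathbb E,\mathfrak s)$ be an $n$-exangulated category in the sense of Herschend–Liu–Nakaoka: $\mathcal C$ is an additive category, $\mathbb E\colon\mathcal C^{\mathrm{op}}\times\mathcal C\to\mathrm{Ab}$ is an additive bifunctor, and $\mathfrak s$ is an exact realization of $\mathbb E$ which satisfies (EA1), (EA2) and (EA2$^{\mathrm{op}}$). The realization assigns to every $\delta\in\mathbb E(C,A)$ a homotopy class $\mathfrak s(\delta)$ of complexes $A=X_0\xrightarrow{\alpha_0}X_1\to\cdots\to X_n\xrightarrow{\alpha_n}X_{n+1}=C$; if $X_\bullet$ lies in this class, the pair $\langle X_\bullet,\delta\rangle$ is called a distinguished $n$-exangle starting at $A$ and ending at $C$. Assume that the category is * $k$-linear: all $\mathcal C(A,B)$ and $\mathbb E(A,B)$ are $k$-modules, and the compositions $\mathcal C(A,B)\times\mathcal C(B,C)\to\mathcal C(A,C)$ and $\mathcal C(A,B)\times\mathbb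 E(B,C)\times\mathcal C(C,F)\to\mathbb E(A,F)$ are $k$-multilinear; * Ext-finite: every $\mathbb E(A,B)$ is a finitely generated $k$-module; * Krull–Schmidt: every object is a finite direct sum of objects with local endomorphism rings. A morphism $f\colon X\to Y$ is *$n$-projectively trivial* if $\mathbb E(f,Z)=0$ for all $Z$, and *$n$-injectively trivial* if $\mathbb E(Z,f)=0$ for all $Z$; an object is *projective* (*injective*) if its identity is $n$-projectively ($n$-injectively) trivial. The stable category $\underline{\mathcal C}$ and the costable category $\overline{\mathcal C}$ have the objects of $\mathcal C$, and their morphisms are those of $\mathcal C$ modulo the $n$-projectively trivial, respectively $n$-injectively trivial, morphisms. A morphism $f\colon A\to B$ is *left almost split* if it is not a split monomorphism and every morphism $A\to W$ that is not a split monomorphism factors through $f$; *right almost split* morphisms are defined dually. A distinguished $n$-exangle as above is an *Auslander–Reiten $n$-exangle* if $\alpha_0$ is left almost split, $\alpha_n$ is right almost split, and, when $n\ge2$, $\alpha_1,\dots,\alpha_{n-1}$ lie in the Jacobson radical of $\mathcal C$. We say that $\mathcal C$ *has Auslander–Reiten $n$-exangles* if for every indecomposable non-projective object there is an Auslander–Reiten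 $n$-exangle ending at it, and for every indecomposable non-injective object there is an Auslander–Reiten $n$-exangle starting at it. We say that $\mathcal C$ *has an Auslander–Reiten–Serre duality* if there are a $k$-linear equivalence $\tau_n\colon\underline{\mathcal C}\to\overline{\mathcal C}$ and $k$-linear isomorphisms $$\Phi_{X,Y}\colon D\,\mathbb E(X,Y)\xrightarrow{\ \cong\ }\overline{\mathcal C}(Y,\tau_nX)\qquad(X,Y\in\mathcal C),$$ natural in both $X$ and $Y$. **Theorem.** Under these assumptions, $\mathcal C$ has Auslander–Reiten $n$-exangles if and only if $\mathcal C$ has an Auslander–Reiten–Serre duality. -/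

import Mathlib

open CategoryTheory CategoryTheory.Limits Opposite
open scoped ZeroObject DirectSum

universe u v w uC

noncomputable section

namespace NExang

attribute [local instance] hasBinaryBiproducts_of_finite_biproducts

/-! ### Complexes concentrated in degrees `0, …, n + 1` with prescribed ends -/

section Complexes

variable {𝒞 : Type uC} [Category.{v} 𝒞] [Preadditive 𝒞]

/-- A complex `X₀ ⟶ X₁ ⟶ ⋯ ⟶ Xₙ₊₁` (zero outside degrees `0, …, n + 1`) with ends `X₀ = A` and
`Xₙ₊₁ = C`. The identification of the ends is recorded by isomorphisms; since `X₀` and `Xₙ₊₁` may be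
replaced by `A` and `C` along these, every such complex is isomorphic, by an isomorphism compatible
with the ends, to one whose ends are literally `A` and `C`. -/
structure EndedComplex (n : ℕ) (A C : 𝒞) where
  cx : CochainComplex 𝒞 ℕ
  isZero : ∀ i, n + 1 < i → IsZero (cx.X i)
  left : A ≅ cx.X 0
  right : cx.X (n + 1) ≅ C

namespace EndedComplex

variable {n : ℕ} {A C A' C' A'' C'' : 𝒞}

/-- The first differential, as a morphism out of the prescribed end `A`. -/
def dFirst (X : EndedComplex n A C) : A ⟶ X.cx.X 1 := X.left.hom ≫ X.cx.d 0 1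

/-- The last differential, as a morphism into the prescribed end `C`. -/
def dLast (X : EndedComplex n A C) : X.cx.X n ⟶ C := X.cx.d n (n + 1) ≫ X.right.hom

/-- The morphism of complexes `f = (a, f₁, …, fₙ, c)` has end components `a` and `c`. -/
structure IsLift (X : EndedComplex n A C) (Y : EndedComplex n A' C') (f : X.cx ⟶ Y.cx)
    (a : A ⟶ A') (c : C ⟶ C') : Prop where
  left : X.left.hom ≫ f.f 0 = a ≫ Y.left.hom
  right : f.f (n + 1) ≫ Y.right.hom = X.right.hom ≫ c

theorem IsLift.id (X : EndedComplex n A C) : IsLift X X (𝟙 X.cx) (𝟙 A) (𝟙 C) :=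
  ⟨by simp, by simp⟩

theorem IsLift.comp {X : EndedComplex n A C} {Y : EndedComplex n A' C'}
    {Z : EndedComplex n A'' C''} {f : X.cx ⟶ Y.cx} {g : Y.cx ⟶ Z.cx} {a : A ⟶ A'} {a' : A' ⟶ A''}
    {c : C ⟶ C'} {c' : C' ⟶ C''} (hf : IsLift X Y f a c) (hg : IsLift Y Z g a' c') :
    IsLift X Z (f ≫ g) (a ≫ a') (c ≫ c') where
  left := by
    rw [HomologicalComplex.comp_f, ← Category.assoc, hf.left, Category.assoc, hg.left,
      Category.assoc]
  right := by
    rw [HomologicalComplex.comp_f, Category.assoc, hg.right, ← Category.assoc, hf.right,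
      Category.assoc]

/-- Homotopy equivalence of complexes with the same ends, through morphisms which are the identity
at both ends. -/
def HtpyEquiv (X Y : EndedComplex n A C) : Prop :=
  ∃ (f : X.cx ⟶ Y.cx) (g : Y.cx ⟶ X.cx), IsLift X Y f (𝟙 A) (𝟙 C) ∧ IsLift Y X g (𝟙 A) (𝟙 C) ∧
    Nonempty (Homotopy (f ≫ g) (𝟙 X.cx)) ∧ Nonempty (Homotopy (g ≫ f) (𝟙 Y.cx))

variable (n A C) in
instance htpySetoid : Setoid (EndedComplex n A C) where
  r := HtpyEquiv
  iseqv :=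
    { refl := fun X => ⟨𝟙 _, 𝟙 _, IsLift.id X, IsLift.id X,
        ⟨Homotopy.ofEq (by simp)⟩, ⟨Homotopy.ofEq (by simp)⟩⟩
      symm := fun ⟨f, g, hf, hg, h₁, h₂⟩ => ⟨g, f, hg, hf, h₂, h₁⟩
      trans := by
        rintro X Y Z ⟨f, g, hf, hg, ⟨h₁⟩, ⟨h₂⟩⟩ ⟨f', g', hf', hg', ⟨h₁'⟩, ⟨h₂'⟩⟩
        let e : HomotopyEquiv X.cx Z.cx :=
          HomotopyEquiv.trans ⟨f, g, h₁, h₂⟩ ⟨f', g', h₁', h₂'⟩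
        refine ⟨e.hom, e.inv, ?_, ?_, ⟨e.homotopyHomInvId⟩, ⟨e.homotopyInvHomId⟩⟩
        · simpa using! hf.comp hf'
        · simpa using! hg'.comp hg }

variable [HasFiniteBiproducts 𝒞]

section Cone

variable {D : 𝒞} (X : EndedComplex n A C) (Y : EndedComplex n A D) (f : X.cx ⟶ Y.cx)

/-- The terms of the mapping cone: `X₁, X₂ ⊞ Y₁, X₃ ⊞ Y₂, …`. -/
def coneX : ℕ → 𝒞
  | 0 => X.cx.X 1
  | i + 1 => X.cx.X (i + 2) ⊞ Y.cx.X (i + 1)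

/-- The differentials of the mapping cone. -/
def coneD : ∀ i, coneX X Y i ⟶ coneX X Y (i + 1)
  | 0 => biprod.lift (-X.cx.d 1 2) (f.f 1)
  | i + 1 => biprod.desc (biprod.lift (-X.cx.d (i + 2) (i + 3)) (f.f (i + 2)))
      (biprod.lift 0 (Y.cx.d (i + 1) (i + 2)))

theorem coneD_comp (i : ℕ) : coneD X Y f i ≫ coneD X Y f (i + 1) = 0 := by
  cases i with
  | zero =>
    have h : biprod.lift (-X.cx.d 1 2) (f.f 1) ≫
        biprod.desc (biprod.lift (-X.cx.d 2 3) (f.f 2)) (biprod.lift 0 (Y.cx.d 1 2)) = 0 := by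
      apply biprod.hom_ext <;> simp
    exact h
  | succ i =>
    have h : biprod.desc (biprod.lift (-X.cx.d (i + 2) (i + 3)) (f.f (i + 2)))
          (biprod.lift 0 (Y.cx.d (i + 1) (i + 2))) ≫
        biprod.desc (biprod.lift (-X.cx.d (i + 3) (i + 4)) (f.f (i + 3)))
          (biprod.lift 0 (Y.cx.d (i + 2) (i + 3))) = 0 := by
      apply biprod.hom_ext <;> apply biprod.hom_ext' <;> simp
    exact h

/-- The mapping cone `X₁ ⟶ X₂ ⊞ Y₁ ⟶ ⋯ ⟶ Xₙ₊₁ ⊞ Yₙ ⟶ Yₙ₊₁` of a morphism `f` with `f₀ = 𝟙`.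
In degree `n + 1` the summand `Xₙ₊₂` is zero. -/
def cone : EndedComplex n (X.cx.X 1) D where
  cx := CochainComplex.of (coneX X Y) (coneD X Y f) (coneD_comp X Y f)
  isZero := by
    intro i hi
    obtain ⟨i, rfl⟩ := Nat.exists_eq_succ_of_ne_zero (by omega : i ≠ 0)
    exact (biprod_isZero_iff _ _).2 ⟨X.isZero _ (by omega), Y.isZero _ (by omega)⟩
  left := Iso.refl _
  right := (isoZeroBiprod (X.isZero (n + 2) (by omega))).symm ≪≫ Y.right

end Cone

/-- The object `X` if `p` holds, and the zero object otherwise. -/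
def cut (p : Prop) [Decidable p] (X : 𝒞) : 𝒞 := if p then X else 0

/-- The identity `X ⟶ cut p X` if `p` holds, and zero otherwise. -/
def cutIn (p : Prop) [Decidable p] (X : 𝒞) : X ⟶ cut p X :=
  if h : p then eqToHom (if_pos h).symm else 0

/-- The identity `cut p X ⟶ X` if `p` holds, and zero otherwise. -/
def cutOut (p : Prop) [Decidable p] (X : 𝒞) : cut p X ⟶ X :=
  if h : p then eqToHom (if_pos h) else 0

theorem isZero_cut (p : Prop) [Decidable p] (X : 𝒞) (h : ¬p) : IsZero (cut p X) := by
  unfold cut; rw [if_neg h]; exact isZero_zero _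

@[simp]
theorem cutOut_cutIn (p : Prop) [Decidable p] (X : 𝒞) : cutOut p X ≫ cutIn p X = 𝟙 _ := by
  by_cases h : p
  · simp only [cutIn, cutOut, dif_pos h]
    exact eqToHom_trans _ _
  · exact (isZero_cut p X h).eq_of_src _ _

theorem cutIn_cutOut (p : Prop) [Decidable p] (X : 𝒞) (h : p) : cutIn p X ≫ cutOut p X = 𝟙 _ := by
  simp only [cutIn, cutOut, dif_pos h]
  exact eqToHom_trans _ _

/-- `cut p X` is `X` if `p` holds. -/
def cutIso (p : Prop) [Decidable p] (X : 𝒞) (h : p) : cut p X ≅ X where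
  hom := cutOut p X
  inv := cutIn p X
  hom_inv_id := cutOut_cutIn p X
  inv_hom_id := cutIn_cutOut p X h

section Cocone

variable {B : 𝒞} (X : EndedComplex n A C) (Y : EndedComplex n B C) (h : X.cx ⟶ Y.cx)

/-- The terms of the mapping cocone: `X₀` in degree `0`, `Xⱼ ⊞ Yⱼ₋₁` in degrees `1 ≤ j ≤ n`,
and `Yₙ` in degree `n + 1`. -/
def coconeX : ℕ → 𝒞
  | 0 => X.cx.X 0
  | i + 1 => cut (i < n) (X.cx.X (i + 1)) ⊞ cut (i ≤ n) (Y.cx.X i)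

/-- The differentials of the mapping cocone. -/
def coconeD : ∀ i, coconeX X Y i ⟶ coconeX X Y (i + 1)
  | 0 => biprod.lift (X.cx.d 0 1 ≫ cutIn _ _) (h.f 0 ≫ cutIn _ _)
  | i + 1 => biprod.desc
      (cutOut _ _ ≫ biprod.lift (X.cx.d (i + 1) (i + 2) ≫ cutIn _ _) (h.f (i + 1) ≫ cutIn _ _))
      (cutOut _ _ ≫ biprod.lift 0 (-Y.cx.d i (i + 1) ≫ cutIn _ _))

theorem coconeD_comp (i : ℕ) : coconeD X Y h i ≫ coconeD X Y h (i + 1) = 0 := by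
  have key : ∀ {P Q R : 𝒞} (u : P ⟶ Q) (w : Q ⟶ R) (p q : Prop) [Decidable p] [Decidable q],
      (q → p) → u ≫ cutIn p Q ≫ cutOut p Q ≫ w ≫ cutIn q R = (u ≫ w) ≫ cutIn q R := by
    intro P Q R u w p q _ _ hqp
    by_cases hq : q
    · rw [← Category.assoc (cutIn p Q), cutIn_cutOut p Q (hqp hq), Category.id_comp,
        Category.assoc]
    · exact (isZero_cut q R hq).eq_of_tgt _ _
  cases i with
  | zero =>
    have e : biprod.lift (X.cx.d 0 1 ≫ cutIn (0 < n) _) (h.f 0 ≫ cutIn (0 ≤ n) _) ≫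
        biprod.desc
          (cutOut _ _ ≫ biprod.lift (X.cx.d 1 2 ≫ cutIn (1 < n) _) (h.f 1 ≫ cutIn (1 ≤ n) _))
          (cutOut _ _ ≫ biprod.lift 0 (-Y.cx.d 0 1 ≫ cutIn (1 ≤ n) _)) = 0 := by
      apply biprod.hom_ext
      · simp [key _ _ (0 < n) (1 < n) (by omega)]
      · simp [key _ _ (0 < n) (1 ≤ n) (by omega), key _ _ (0 ≤ n) (1 ≤ n) (by omega)]
    exact e
  | succ i =>
    have e : biprod.desc
          (cutOut (i < n) _ ≫ biprod.lift (X.cx.d (i + 1) (i + 2) ≫ cutIn (i + 1 < n) _)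
            (h.f (i + 1) ≫ cutIn (i + 1 ≤ n) _))
          (cutOut (i ≤ n) _ ≫ biprod.lift 0 (-Y.cx.d i (i + 1) ≫ cutIn (i + 1 ≤ n) _)) ≫
        biprod.desc
          (cutOut _ _ ≫ biprod.lift (X.cx.d (i + 2) (i + 3) ≫ cutIn (i + 2 < n) _)
            (h.f (i + 2) ≫ cutIn (i + 2 ≤ n) _))
          (cutOut _ _ ≫ biprod.lift 0 (-Y.cx.d (i + 1) (i + 2) ≫ cutIn (i + 2 ≤ n) _)) = 0 := by
      apply biprod.hom_ext <;> apply biprod.hom_ext'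
      · simp [key _ _ (i + 1 < n) (i + 2 < n) (by omega)]
      · simp
      · simp [key _ _ (i + 1 < n) (i + 2 ≤ n) (by omega),
          key _ _ (i + 1 ≤ n) (i + 2 ≤ n) (by omega)]
      · simp [key _ _ (i + 1 ≤ n) (i + 2 ≤ n) (by omega)]
    exact e

/-- The mapping cocone `X₀ ⟶ X₁ ⊞ Y₀ ⟶ ⋯ ⟶ Xₙ ⊞ Yₙ₋₁ ⟶ Yₙ` of a morphism `h` with
`hₙ₊₁ = 𝟙`. -/
def cocone : EndedComplex n A (Y.cx.X n) where
  cx := CochainComplex.of (coconeX X Y) (coconeD X Y h) (coconeD_comp X Y h)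
  isZero := by
    intro i hi
    obtain ⟨i, rfl⟩ := Nat.exists_eq_succ_of_ne_zero (by omega : i ≠ 0)
    exact (biprod_isZero_iff _ _).2 ⟨isZero_cut _ _ (by omega), isZero_cut _ _ (by omega)⟩
  left := X.left
  right := (isoZeroBiprod (isZero_cut (n < n) (X.cx.X (n + 1)) (lt_irrefl n))).symm ≪≫
    cutIso (n ≤ n) (Y.cx.X n) le_rfl

end Cocone

end EndedComplex

end Complexes

/-! ### Bifunctors of extensions -/

section Extensions

variable {k : Type u} [CommRing k] {𝒞 : Type uC} [Category.{v} 𝒞] [Preadditive 𝒞]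

section

variable (E : 𝒞ᵒᵖ ⥤ 𝒞 ⥤ ModuleCat.{w} k)

/-- The `k`-module `𝔼(C, A)` of extensions. -/
abbrev Ext (C A : 𝒞) : Type w := (E.obj (op C)).obj A

/-- `a_* : 𝔼(C, A) → 𝔼(C, A')`. -/
def push (C : 𝒞) {A A' : 𝒞} (a : A ⟶ A') : Ext E C A →ₗ[k] Ext E C A' :=
  ((E.obj (op C)).map a).hom

/-- `c^* : 𝔼(C, A) → 𝔼(C', A)`. -/
def pull {C C' : 𝒞} (c : C' ⟶ C) (A : 𝒞) : Ext E C A →ₗ[k] Ext E C' A :=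
  ((E.map c.op).app A).hom

/-- `𝔼` is a `k`-bilinear bifunctor; in particular it is additive in each variable. -/
class IsBilinear [Linear k 𝒞] : Prop where
  push_add : ∀ (C : 𝒞) {A A' : 𝒞} (a b : A ⟶ A'), push E C (a + b) = push E C a + push E C b
  push_smul : ∀ (C : 𝒞) {A A' : 𝒞} (r : k) (a : A ⟶ A'), push E C (r • a) = r • push E C a
  pull_add : ∀ {C C' : 𝒞} (c d : C' ⟶ C) (A : 𝒞), pull E (c + d) A = pull E c A + pull E d A
  pull_smul : ∀ {C C' : 𝒞} (r : k) (c : C' ⟶ C) (A : 𝒞), pull E (r • c) A = r • pull E c A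

end

/-! ### `n`-exangulated categories -/

section Exangulated

variable (E : 𝒞ᵒᵖ ⥤ 𝒞 ⥤ ModuleCat.{w} k) {n : ℕ}

/-- The pair `⟨X, δ⟩` is an `n`-exangle: an `𝔼`-attached complex such that the two associated
sequences of functors
`𝒞(-, X₀) → ⋯ → 𝒞(-, Xₙ₊₁) → 𝔼(-, X₀)` and `𝒞(Xₙ₊₁, -) → ⋯ → 𝒞(X₀, -) → 𝔼(Xₙ₊₁, -)`
are exact. -/
structure IsNExangle {A C : 𝒞} (X : EndedComplex n A C) (δ : Ext E C A) : Prop where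
  push_dFirst : push E C X.dFirst δ = 0
  pull_dLast : pull E X.dLast A δ = 0
  exact_left : ∀ i < n, ∀ (W : 𝒞) (g : W ⟶ X.cx.X (i + 1)), g ≫ X.cx.d (i + 1) (i + 2) = 0 →
    ∃ h : W ⟶ X.cx.X i, h ≫ X.cx.d i (i + 1) = g
  exact_left_last : ∀ (W : 𝒞) (g : W ⟶ C), pull E g A δ = 0 → ∃ h : W ⟶ X.cx.X n, h ≫ X.dLast = g
  exact_right : ∀ i < n, ∀ (W : 𝒞) (g : X.cx.X (i + 1) ⟶ W), X.cx.d i (i + 1) ≫ g = 0 →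
    ∃ h : X.cx.X (i + 2) ⟶ W, X.cx.d (i + 1) (i + 2) ≫ h = g
  exact_right_first : ∀ (W : 𝒞) (g : A ⟶ W), push E C g δ = 0 →
    ∃ h : X.cx.X 1 ⟶ W, X.dFirst ≫ h = g

variable (n) in
/-- A correspondence sending each extension `δ ∈ 𝔼(C, A)` to a homotopy equivalence class of
complexes with ends `A` and `C`. -/
abbrev Correspondence := ∀ {A C : 𝒞}, Ext E C A → Quotient (EndedComplex.htpySetoid n A C)

variable {E}

/-- `X` realizes `δ`, i.e. `𝔰(δ) = [X]`. -/
def Realizes (s : Correspondence E n) {A C : 𝒞} (δ : Ext E C A) (X : EndedComplex n A C) : Prop :=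
  s δ = Quotient.mk _ X

/-- `f` is an `𝔰`-inflation: the first differential of some conflation. -/
def IsInflation (s : Correspondence E n) {A B : 𝒞} (f : A ⟶ B) : Prop :=
  ∃ (C : 𝒞) (δ : Ext E C A) (X : EndedComplex n A C) (e : X.cx.X 1 ≅ B),
    Realizes s δ X ∧ X.dFirst ≫ e.hom = f

/-- `g` is an `𝔰`-deflation: the last differential of some conflation. -/
def IsDeflation (s : Correspondence E n) {B C : 𝒞} (g : B ⟶ C) : Prop :=
  ∃ (A : 𝒞) (δ : Ext E C A) (X : EndedComplex n A C) (e : B ≅ X.cx.X n),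
    Realizes s δ X ∧ e.hom ≫ X.dLast = g

variable (E n)

/-- A `k`-linear `n`-exangulated structure `(𝒞, 𝔼, 𝔰)` on an additive `k`-linear category: a
`k`-bilinear bifunctor `𝔼` together with an exact realization `𝔰` of `𝔼` satisfying (EA1), (EA2)
and (EA2ᵒᵖ). -/
structure NExangulated [Linear k 𝒞] [HasFiniteBiproducts 𝒞] [IsBilinear E] where
  /-- the realization `𝔰` -/
  s : Correspondence E n
  /-- (R0) -/
  exists_lift : ∀ {A C A' C' : 𝒞} (δ : Ext E C A) (ρ : Ext E C' A')
    (X : EndedComplex n A C) (Y : EndedComplex n A' C'), Realizes s δ X → Realizes s ρ Y →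
    ∀ (a : A ⟶ A') (c : C ⟶ C'), push E C a δ = pull E c A' ρ →
      ∃ f : X.cx ⟶ Y.cx, EndedComplex.IsLift X Y f a c
  /-- (R1) -/
  isNExangle : ∀ {A C : 𝒞} (δ : Ext E C A) (X : EndedComplex n A C), Realizes s δ X →
    IsNExangle E X δ
  /-- (R2): `𝔰(₀0_A)` is the class of `A ⟶ A ⟶ 0 ⟶ ⋯ ⟶ 0` (identity in degree `0`). -/
  realizes_zero_right : ∀ (A Z : 𝒞), IsZero Z → ∀ X : EndedComplex n A Z, IsIso X.dFirst →
    (∀ i, 2 ≤ i → IsZero (X.cx.X i)) → Realizes s (0 : Ext E Z A) X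
  /-- (R2), dual part: the class of `0 ⟶ ⋯ ⟶ 0 ⟶ A ⟶ A` (identity in degree `n`). -/
  realizes_zero_left : ∀ (Z A : 𝒞), IsZero Z → ∀ X : EndedComplex n Z A, IsIso X.dLast →
    (∀ i, i < n → IsZero (X.cx.X i)) → Realizes s (0 : Ext E A Z) X
  /-- (EA1) -/
  inflation_comp : ∀ {A B C : 𝒞} (f : A ⟶ B) (g : B ⟶ C),
    IsInflation s f → IsInflation s g → IsInflation s (f ≫ g)
  /-- (EA1), dual part -/
  deflation_comp : ∀ {A B C : 𝒞} (f : A ⟶ B) (g : B ⟶ C),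
    IsDeflation s f → IsDeflation s g → IsDeflation s (f ≫ g)
  /-- (EA2) -/
  exists_good_lift : ∀ {A C D : 𝒞} (ρ : Ext E D A) (c : C ⟶ D)
    (X : EndedComplex n A C) (Y : EndedComplex n A D),
    Realizes s (pull E c A ρ) X → Realizes s ρ Y →
      ∃ f : X.cx ⟶ Y.cx, EndedComplex.IsLift X Y f (𝟙 A) c ∧
        Realizes s (push E D X.dFirst ρ) (EndedComplex.cone X Y f)
  /-- (EA2ᵒᵖ) -/
  exists_good_lift_op : ∀ {A B C : 𝒞} (ρ : Ext E C A) (a : A ⟶ B)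
    (X : EndedComplex n A C) (Y : EndedComplex n B C),
    Realizes s ρ X → Realizes s (push E C a ρ) Y →
      ∃ h : X.cx ⟶ Y.cx, EndedComplex.IsLift X Y h a (𝟙 C) ∧
        Realizes s (pull E Y.dLast A ρ) (EndedComplex.cocone X Y h)

end Exangulated

/-! ### Projective and injective objects, stable and costable categories -/

section Stable

variable (E : 𝒞ᵒᵖ ⥤ 𝒞 ⥤ ModuleCat.{w} k)

/-- `f` is `n`-projectively trivial: `𝔼(f, Z) = 0` for all `Z`. -/
def ProjTrivial {X Y : 𝒞} (f : X ⟶ Y) : Prop := ∀ Z : 𝒞, pull E f Z = 0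

/-- `g` is `n`-injectively trivial: `𝔼(Z, g) = 0` for all `Z`. -/
def InjTrivial {X Y : 𝒞} (g : X ⟶ Y) : Prop := ∀ Z : 𝒞, push E Z g = 0

/-- Projective objects of `(𝒞, 𝔼, 𝔰)`. -/
def IsProjObj (C : 𝒞) : Prop := ProjTrivial E (𝟙 C)

/-- Injective objects of `(𝒞, 𝔼, 𝔰)`. -/
def IsInjObj (C : 𝒞) : Prop := InjTrivial E (𝟙 C)

/-- Congruence modulo the `n`-projectively trivial morphisms. -/
def projRel : HomRel 𝒞 := fun _ _ f g => ProjTrivial E (f - g)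

/-- Congruence modulo the `n`-injectively trivial morphisms. -/
def injRel : HomRel 𝒞 := fun _ _ f g => InjTrivial E (f - g)

/-- The stable category, with morphisms `𝒞(A, B) / 𝒫(A, B)`. -/
abbrev Stable := CategoryTheory.Quotient (projRel E)

/-- The costable category, with morphisms `𝒞(A, B) / ℐ(A, B)`. -/
abbrev Costable := CategoryTheory.Quotient (injRel E)

/-- The quotient functor `𝒞 ⥤ 𝒞/𝒫`. -/
abbrev toStable : 𝒞 ⥤ Stable E := CategoryTheory.Quotient.functor (projRel E)

/-- The quotient functor `𝒞 ⥤ 𝒞/ℐ`. -/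
abbrev toCostable : 𝒞 ⥤ Costable E := CategoryTheory.Quotient.functor (injRel E)

theorem pull_comp {A B C : 𝒞} (f : A ⟶ B) (g : B ⟶ C) (Z : 𝒞) :
    pull E (f ≫ g) Z = pull E f Z ∘ₗ pull E g Z := by
  simp [pull]

theorem push_comp (Z : 𝒞) {A B C : 𝒞} (f : A ⟶ B) (g : B ⟶ C) :
    push E Z (f ≫ g) = push E Z g ∘ₗ push E Z f := by
  simp [push]

variable [Linear k 𝒞] [IsBilinear E]

/-- `c ↦ c^*` as a `k`-linear map. -/
def pullHom (A B Z : 𝒞) : (A ⟶ B) →ₗ[k] (Ext E B Z →ₗ[k] Ext E A Z) where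
  toFun f := pull E f Z
  map_add' f g := IsBilinear.pull_add f g Z
  map_smul' r f := IsBilinear.pull_smul r f Z

/-- `a ↦ a_*` as a `k`-linear map. -/
def pushHom (A B Z : 𝒞) : (A ⟶ B) →ₗ[k] (Ext E Z A →ₗ[k] Ext E Z B) where
  toFun f := push E Z f
  map_add' f g := IsBilinear.push_add Z f g
  map_smul' r f := IsBilinear.push_smul Z r f

theorem projRel_iff {A B : 𝒞} (f g : A ⟶ B) : projRel E f g ↔ ∀ Z, pull E f Z = pull E g Z :=
  forall_congr' fun Z => by
    rw [← sub_eq_zero (a := pull E f Z)]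
    exact Eq.congr_left ((pullHom E A B Z).map_sub f g)

theorem injRel_iff {A B : 𝒞} (f g : A ⟶ B) : injRel E f g ↔ ∀ Z, push E Z f = push E Z g :=
  forall_congr' fun Z => by
    rw [← sub_eq_zero (a := push E Z f)]
    exact Eq.congr_left ((pushHom E A B Z).map_sub f g)

instance : Congruence (projRel E) where
  equivalence :=
    { refl := fun _ => (projRel_iff E _ _).2 fun _ => rfl
      symm := fun h => (projRel_iff E _ _).2 fun Z => ((projRel_iff E _ _).1 h Z).symm
      trans := fun h h' => (projRel_iff E _ _).2 fun Z =>
        ((projRel_iff E _ _).1 h Z).trans ((projRel_iff E _ _).1 h' Z) }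
  comp_left f _ _ h := (projRel_iff E _ _).2 fun Z => by
    rw [pull_comp, pull_comp, (projRel_iff E _ _).1 h Z]
  comp_right g h := (projRel_iff E _ _).2 fun Z => by
    rw [pull_comp, pull_comp, (projRel_iff E _ _).1 h Z]

instance : Congruence (injRel E) where
  equivalence :=
    { refl := fun _ => (injRel_iff E _ _).2 fun _ => rfl
      symm := fun h => (injRel_iff E _ _).2 fun Z => ((injRel_iff E _ _).1 h Z).symm
      trans := fun h h' => (injRel_iff E _ _).2 fun Z =>
        ((injRel_iff E _ _).1 h Z).trans ((injRel_iff E _ _).1 h' Z) }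
  comp_left f _ _ h := (injRel_iff E _ _).2 fun Z => by
    rw [push_comp, push_comp, (injRel_iff E _ _).1 h Z]
  comp_right g h := (injRel_iff E _ _).2 fun Z => by
    rw [push_comp, push_comp, (injRel_iff E _ _).1 h Z]

theorem projRel_add ⦃A B : 𝒞⦄ (f₁ f₂ g₁ g₂ : A ⟶ B) (hf : projRel E f₁ f₂)
    (hg : projRel E g₁ g₂) : projRel E (f₁ + g₁) (f₂ + g₂) := (projRel_iff E _ _).2 fun Z => by
  rw [IsBilinear.pull_add, IsBilinear.pull_add, (projRel_iff E _ _).1 hf Z,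
    (projRel_iff E _ _).1 hg Z]

theorem injRel_add ⦃A B : 𝒞⦄ (f₁ f₂ g₁ g₂ : A ⟶ B) (hf : injRel E f₁ f₂)
    (hg : injRel E g₁ g₂) : injRel E (f₁ + g₁) (f₂ + g₂) := (injRel_iff E _ _).2 fun Z => by
  rw [IsBilinear.push_add, IsBilinear.push_add, (injRel_iff E _ _).1 hf Z,
    (injRel_iff E _ _).1 hg Z]

theorem projRel_smul (r : k) ⦃A B : 𝒞⦄ (f₁ f₂ : A ⟶ B) (hf : projRel E f₁ f₂) :
    projRel E (r • f₁) (r • f₂) := (projRel_iff E _ _).2 fun Z => by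
  rw [IsBilinear.pull_smul, IsBilinear.pull_smul, (projRel_iff E _ _).1 hf Z]

theorem injRel_smul (r : k) ⦃A B : 𝒞⦄ (f₁ f₂ : A ⟶ B) (hf : injRel E f₁ f₂) :
    injRel E (r • f₁) (r • f₂) := (injRel_iff E _ _).2 fun Z => by
  rw [IsBilinear.push_smul, IsBilinear.push_smul, (injRel_iff E _ _).1 hf Z]

instance : Preadditive (Stable E) := Quotient.preadditive _ (projRel_add E)

instance : Preadditive (Costable E) := Quotient.preadditive _ (injRel_add E)

instance : (toStable E).Additive := Quotient.functor_additive _ (projRel_add E)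

instance : (toCostable E).Additive := Quotient.functor_additive _ (injRel_add E)

instance : Linear k (Stable E) := Quotient.linear k _ (projRel_smul E)

instance : Linear k (Costable E) := Quotient.linear k _ (injRel_smul E)

end Stable

/-! ### Auslander–Reiten–Serre duality -/

/-- `I` is a minimal injective cogenerator of `k`: an injective envelope of the direct sum of one
copy of each simple `k`-module. -/
def IsMinimalInjectiveCogenerator (k : Type u) [CommRing k] (I : Type u) [AddCommGroup I]
    [Module k I] : Prop :=
  Module.Injective k I ∧
    ∃ j : (⨁ m : MaximalSpectrum k, k ⧸ m.asIdeal) →ₗ[k] I, Function.Injective j ∧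
      ∀ N : Submodule k I, N ⊓ LinearMap.range j = ⊥ → N = ⊥

/-- `(𝒞, 𝔼, 𝔰)` has Auslander–Reiten–Serre duality, with `D = Hom_k(-, I)`: there is a `k`-linear
equivalence `τ` from the stable to the costable category and `k`-linear isomorphisms
`Φ_{X, Y} : D 𝔼(X, Y) ≅ (𝒞/ℐ)(Y, τ X)`, natural in `X` and `Y`. -/
def HasARSDuality (E : 𝒞ᵒᵖ ⥤ 𝒞 ⥤ ModuleCat.{w} k) [Linear k 𝒞] [IsBilinear E]
    (I : Type u) [AddCommGroup I] [Module k I] : Prop :=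
  ∃ τ : Stable E ⥤ Costable E, τ.IsEquivalence ∧ τ.Additive ∧ Functor.Linear k τ ∧
    ∃ Φ : ∀ X Y : 𝒞,
        (Ext E X Y →ₗ[k] I) ≃ₗ[k] ((toCostable E).obj Y ⟶ τ.obj ((toStable E).obj X)),
      ∀ {X X' Y Y' : 𝒞} (x : X ⟶ X') (y : Y' ⟶ Y) (φ : Ext E X Y →ₗ[k] I),
        Φ X' Y' (φ ∘ₗ pull E x Y ∘ₗ push E X' y) =
          (toCostable E).map y ≫ Φ X Y φ ≫ τ.map ((toStable E).map x)

/-! ### Auslander–Reiten `n`-exangles -/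

section AR

/-- `f` is left almost split: it is not a split monomorphism, and every morphism out of its source
which is not a split monomorphism factors through it. -/
def LeftAlmostSplit {A B : 𝒞} (f : A ⟶ B) : Prop :=
  ¬IsSplitMono f ∧ ∀ (W : 𝒞) (g : A ⟶ W), ¬IsSplitMono g → ∃ h : B ⟶ W, f ≫ h = g

/-- `f` is right almost split: it is not a split epimorphism, and every morphism into its target
which is not a split epimorphism factors through it. -/
def RightAlmostSplit {B C : 𝒞} (f : B ⟶ C) : Prop :=
  ¬IsSplitEpi f ∧ ∀ (W : 𝒞) (g : W ⟶ C), ¬IsSplitEpi g → ∃ h : W ⟶ B, h ≫ f = g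

/-- `f` lies in the Jacobson radical of `𝒞`. -/
def InRadical {A B : 𝒞} (f : A ⟶ B) : Prop := ∀ g : B ⟶ A, IsIso (𝟙 A - f ≫ g)

variable [Linear k 𝒞] [HasFiniteBiproducts 𝒞] {E : 𝒞ᵒᵖ ⥤ 𝒞 ⥤ ModuleCat.{w} k} [IsBilinear E]
  {n : ℕ}

/-- The distinguished `n`-exangle `⟨X, δ⟩` is an Auslander–Reiten `n`-exangle. -/
structure IsARExangle (S : NExangulated E n) {A C : 𝒞} (X : EndedComplex n A C) (δ : Ext E C A) :
    Prop where
  realizes : Realizes S.s δ X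
  left : LeftAlmostSplit X.dFirst
  right : RightAlmostSplit X.dLast
  radical : ∀ i, 1 ≤ i → i < n → InRadical (X.cx.d i (i + 1))

/-- Every indecomposable non-projective object is the end of an Auslander–Reiten `n`-exangle. -/
def HasRightARExangles (S : NExangulated E n) : Prop :=
  ∀ C : 𝒞, Indecomposable C → ¬IsProjObj E C →
    ∃ (A : 𝒞) (X : EndedComplex n A C) (δ : Ext E C A), IsARExangle S X δ

/-- Every indecomposable non-injective object is the start of an Auslander–Reiten `n`-exangle. -/
def HasLeftARExangles (S : NExangulated E n) : Prop :=
  ∀ A : 𝒞, Indecomposable A → ¬IsInjObj E A →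
    ∃ (C : 𝒞) (X : EndedComplex n A C) (δ : Ext E C A), IsARExangle S X δ

/-- `(𝒞, 𝔼, 𝔰)` has Auslander–Reiten `n`-exangles. -/
def HasARExangles (S : NExangulated E n) : Prop := HasRightARExangles S ∧ HasLeftARExangles S

end AR

/-- `𝒞` is Krull–Schmidt: every object is a finite direct sum of objects with local endomorphism
rings. -/
def IsKrullSchmidt (𝒞 : Type uC) [Category.{v} 𝒞] [Preadditive 𝒞] [HasFiniteBiproducts 𝒞] : Prop :=
  ∀ X : 𝒞, ∃ (m : ℕ) (Y : Fin m → 𝒞), (∀ i, IsLocalRing (End (Y i))) ∧ Nonempty (X ≅ ⨁ Y)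

/-- `(𝒞, 𝔼, 𝔰)` is Ext-finite. -/
def IsExtFinite (E : 𝒞ᵒᵖ ⥤ 𝒞 ⥤ ModuleCat.{w} k) : Prop :=
  ∀ C A : 𝒞, Module.Finite k (Ext E C A)

end Extensions

end NExang

end

/-!
Both directions reduce to a statement about the bifunctor `𝔼` alone. An extension `δ ∈ 𝔼(C, A)` is
called *almost split* (`IsAlmostSplit`) if it is nonzero, and annihilated by every morphism to `C`
which is not a split epimorphism and every morphism from `A` which is not a split monomorphism. The
extension of an Auslander–Reiten `n`-exangle is almost split. Conversely, a conflation of an almost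
split extension has almost split ends, and among its homotopy equivalent forms there is one with
radical inner differentials: in a Krull–Schmidt category a non-radical differential has an
invertible component between indecomposable summands, which splits off
(`EndedComplex.exists_radical`).

The axioms (EA2) and (EA2ᵒᵖ) enter only through `NExangulated.exists_push_eq` and
`NExangulated.exists_pull_eq`: an extension killed by all morphisms which kill `μ` is a pushforward,
respectively a pullback, of `μ`. Hence an almost split `δ ∈ 𝔼(C, A)` is a pushforward of every
nonzero `μ ∈ 𝔼(C, Y)` and a pullback of every nonzero `μ ∈ 𝔼(Z, A)`.

*From exangles to duality.* Let `φ : 𝔼(C, A) ⟶ I` be a functional with `φ δ ≠ 0`. By the previous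
remark the pairings `(𝒞/ℐ)(Y, A) × 𝔼(C, Y) ⟶ I` and `(𝒞/𝒫)(C, Z) × 𝔼(Z, A) ⟶ I` induced by `φ` are
nondegenerate. Since `𝔼` has values of finite length and `D` does not increase the length
(`length_dual_le`, which uses the minimality of `I`), they identify the costable and stable
morphisms with `D 𝔼(C, Y)` and `D 𝔼(Z, A)`. Such functionals are called *dualizing*
(`IsDualizing`); they add up along direct sums, so that every object is the first and the second
argument of one. A choice of dualizing functionals `φ_X` on `𝔼(X, τ X)` is the same as a family of
representations of the functors `D 𝔼(X, -)` by `τ X`; the Yoneda lemma makes `τ` a functor, which is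
fully faithful by the second pairing.

*From duality to exangles.* If `τ C ≅ A` in the costable category with `C` and `A` indecomposable,
then `D 𝔼(C, A)` is identified with the local ring `(𝒞/ℐ)(A, A)`. The functionals corresponding to
its radical form a proper submodule, so they all vanish at some nonzero `δ`, which is almost split
by the naturality of the duality (`exists_isAlmostSplit`).
-/

set_option linter.unusedSectionVars false

noncomputable section

namespace NExang

attribute [local instance] hasBinaryBiproducts_of_finite_biproducts

/-! ### Matlis duality over a commutative artinian ring -/

section Matlis

variable {k : Type u} [CommRing k] {I : Type u} [AddCommGroup I] [Module k I]

namespace IsMinimalInjectiveCogenerator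

theorem baer (hI : IsMinimalInjectiveCogenerator k I) : Module.Baer k I :=
  Module.Baer.of_injective hI.1

/-- `I` is a cogenerator: functionals with values in `I` separate points. -/
theorem exists_apply_ne_zero (hI : IsMinimalInjectiveCogenerator k I) {N : Type w}
    [AddCommGroup N] [Module k N] {x : N} (hx : x ≠ 0) : ∃ φ : N →ₗ[k] I, φ x ≠ 0 := by
  classical
  obtain ⟨j, hj, -⟩ := hI.2
  -- The cyclic module `k x` maps onto a simple module, which embeds into `I`.
  let T := LinearMap.ker (LinearMap.toSpanSingleton k N x)
  have hT : T ≠ ⊤ := fun h => hx <| by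
    have : (1 : k) ∈ T := h ▸ Submodule.mem_top
    simpa [T] using this
  obtain ⟨m, hm, hTm⟩ := Ideal.exists_le_maximal T hT
  let g : (k ⧸ T) →ₗ[k] I := j ∘ₗ DirectSum.lof k (MaximalSpectrum k)
    (fun m => k ⧸ m.asIdeal) ⟨m, hm⟩ ∘ₗ Submodule.factor hTm
  let i : (k ⧸ T) →ₗ[k] N := T.liftQ (LinearMap.toSpanSingleton k N x) le_rfl
  have hi : Function.Injective i := LinearMap.ker_eq_bot.1 (Submodule.ker_liftQ_eq_bot' _ _ rfl)
  obtain ⟨φ, hφ⟩ := hI.baer.extension_property i hi g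
  refine ⟨φ, fun h => ?_⟩
  have h1 : g (Submodule.Quotient.mk 1) = 0 := by
    rw [← hφ]
    have hi1 : i (Submodule.Quotient.mk 1) = x := by
      rw [Submodule.liftQ_apply]
      simp
    rw [LinearMap.comp_apply, hi1, h]
  have h2 : (Submodule.Quotient.mk 1 : k ⧸ m) = 0 :=
    (DirectSum.of_injective (β := fun m : MaximalSpectrum k => k ⧸ m.asIdeal) ⟨m, hm⟩) <| by
      rw [map_zero]
      exact hj (by rw [map_zero]; exact h1)
  rw [Submodule.Quotient.mk_eq_zero] at h2
  exact hm.ne_top ((Ideal.eq_top_iff_one _).2 h2)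

/-- By minimality the socle of `I` contains each simple module only once. -/
theorem length_dual_quotient_le (hI : IsMinimalInjectiveCogenerator k I)
    (m : MaximalSpectrum k) : Module.length k ((k ⧸ m.asIdeal) →ₗ[k] I) ≤ 1 := by
  classical
  obtain ⟨j, hj, hess⟩ := hI.2
  have hm := m.isMaximal
  have : IsSimpleModule k (k ⧸ m.asIdeal) := isSimpleModule_iff_quot_maximal.2
    ⟨_, hm, ⟨LinearEquiv.refl _ _⟩⟩
  rw [← Module.length_eq_one k (k ⧸ m.asIdeal)]
  let _ : Field (k ⧸ m.asIdeal) := Ideal.Quotient.field _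
  let L := DirectSum.lof k (MaximalSpectrum k) (fun m => k ⧸ m.asIdeal) m
  refine Module.length_le_of_surjective
    (LinearMap.compRight k (j ∘ₗ L) ∘ₗ LinearMap.mul k (k ⧸ m.asIdeal)) fun f => ?_
  obtain ⟨z, hz⟩ : ∃ z, j z = f 1 := by
    by_cases hf : f = 0
    · exact ⟨0, by simp [hf]⟩
    have hne : LinearMap.range f ⊓ LinearMap.range j ≠ ⊥ := fun h =>
      hf (LinearMap.range_eq_bot.1 (hess _ h))
    obtain ⟨_, ⟨⟨t, rfl⟩, ⟨z, hz⟩⟩, ht⟩ := Submodule.exists_mem_ne_zero_of_ne_bot hne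
    have ht0 : t ≠ 0 := by rintro rfl; exact ht (map_zero f)
    obtain ⟨r, hr⟩ := Ideal.Quotient.mk_surjective (t⁻¹)
    refine ⟨r • z, ?_⟩
    rw [map_smul, hz, ← map_smul, Algebra.smul_def]
    congr 1
    change Ideal.Quotient.mk _ r * t = 1
    rw [hr, inv_mul_cancel₀ ht0]
  have hz0 : ∀ m' : MaximalSpectrum k, m' ≠ m → z m' = 0 := by
    intro m' hne
    have hnle : ¬ m.asIdeal ≤ m'.asIdeal := fun hle =>
      hne (MaximalSpectrum.ext (hm.eq_of_le m'.isMaximal.ne_top hle).symm)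
    obtain ⟨r, hrm, hrm'⟩ := Set.not_subset.1 hnle
    have hrz : r • z = 0 := hj <| by
      rw [map_smul, hz, map_zero, ← map_smul, Algebra.smul_def, mul_one]
      change f (Ideal.Quotient.mk _ r) = 0
      rw [Ideal.Quotient.eq_zero_iff_mem.2 hrm, map_zero]
    have h0 : r • z m' = 0 := by rw [← DirectSum.smul_apply, hrz]; rfl
    have := m'.isMaximal
    let _ : Field (k ⧸ m'.asIdeal) := Ideal.Quotient.field _
    rw [Algebra.smul_def] at h0
    refine (mul_eq_zero.1 h0).resolve_left fun h => hrm' ?_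
    exact Ideal.Quotient.eq_zero_iff_mem.1 h
  refine ⟨z m, ?_⟩
  have hLz : L (z m) = z := by
    refine DFinsupp.ext fun m' => ?_
    by_cases h : m' = m
    · subst h
      exact DirectSum.of_eq_same _ _
    · rw [hz0 m' h]
      exact DirectSum.of_eq_of_ne _ _ _ h
  ext
  simp [hLz, hz]

theorem length_dual_le_of_isSimpleModule (hI : IsMinimalInjectiveCogenerator k I) (N : Type w)
    [AddCommGroup N] [Module k N] [IsSimpleModule k N] : Module.length k (N →ₗ[k] I) ≤ 1 := by
  obtain ⟨m, hm, ⟨e⟩⟩ := isSimpleModule_iff_quot_maximal.1 (inferInstance : IsSimpleModule k N)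
  rw [(LinearEquiv.congrLeft I k e).length_eq]
  exact hI.length_dual_quotient_le ⟨m, hm⟩

theorem length_dual_le (hI : IsMinimalInjectiveCogenerator k I) {N : Type w}
    [AddCommGroup N] [Module k N] (hN : IsFiniteLength k N) :
    Module.length k (N →ₗ[k] I) ≤ Module.length k N := by
  induction hN with
  | of_subsingleton => simp [Module.length_eq_zero]
  | @of_simple_quotient N _ _ P _ _ ih =>
    have h := Module.length_eq_add_of_exact (R := k) (LinearMap.lcomp k I P.mkQ)
      (LinearMap.lcomp k I P.subtype) ?_ ?_ ?_
    · have h' := Module.length_eq_add_of_exact (R := k) P.subtype P.mkQ P.injective_subtype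
        P.mkQ_surjective (LinearMap.exact_subtype_mkQ P)
      rw [h, h', Module.length_eq_one k (N ⧸ P), add_comm]
      exact add_le_add ih (hI.length_dual_le_of_isSimpleModule _)
    · intro f g hfg
      exact LinearMap.cancel_right P.mkQ_surjective |>.1 hfg
    · intro g
      exact hI.baer.extension_property _ P.injective_subtype g
    · intro f
      constructor
      · intro hf
        refine ⟨P.liftQ f fun x hx => LinearMap.congr_fun hf ⟨x, hx⟩, ?_⟩
        ext x; rfl
      · rintro ⟨g, rfl⟩
        ext x
        change g (Submodule.Quotient.mk (x : N)) = 0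
        rw [(Submodule.Quotient.mk_eq_zero P).2 x.2, map_zero]

/-- A submodule of the Matlis dual of a finitely generated module which separates points is the
whole dual: `N` embeds into the dual of `P`, so that
`length N ≤ length P ≤ length (N →ₗ[k] I) ≤ length N`. -/
theorem eq_top_of_separates [IsArtinianRing k] (hI : IsMinimalInjectiveCogenerator k I)
    {N : Type w} [AddCommGroup N] [Module k N] [Module.Finite k N] (P : Submodule k (N →ₗ[k] I))
    (hP : ∀ x : N, (∀ φ ∈ P, φ x = 0) → x = 0) : P = ⊤ := by
  have hN : IsFiniteLength k N := isFiniteLength_iff_isNoetherian_isArtinian.2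
    ⟨inferInstance, inferInstance⟩
  have hle := hI.length_dual_le hN
  have hD : IsFiniteLength k (N →ₗ[k] I) := Module.length_ne_top_iff.1
    (ne_top_of_le_ne_top (Module.length_ne_top_iff.2 hN) hle)
  obtain ⟨_, _⟩ := isFiniteLength_iff_isNoetherian_isArtinian.1 hD
  have hPf : IsFiniteLength k P := isFiniteLength_iff_isNoetherian_isArtinian.2
    ⟨inferInstance, inferInstance⟩
  by_contra hne
  have hinj : Function.Injective (LinearMap.flip P.subtype) := by
    rw [injective_iff_map_eq_zero]
    exact fun x hx => hP x fun φ hφ => LinearMap.congr_fun hx ⟨φ, hφ⟩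
  exact absurd (Submodule.length_lt hne) (not_lt.2 (hle.trans
    ((Module.length_le_of_injective _ hinj).trans (hI.length_dual_le hPf))))

end IsMinimalInjectiveCogenerator

end Matlis

/-! ### Lifting extensions along the ends of an `n`-exangle -/

section Ends

variable {𝒞 : Type uC} [Category.{v} 𝒞] [Preadditive 𝒞] [HasFiniteBiproducts 𝒞] {n : ℕ}

namespace EndedComplex

/-- Morphisms out of the first term `X₁ ⊞ Y₀` of a cocone, in components. -/
theorem exists_cocone_dFirst_comp {A B C : 𝒞} (X : EndedComplex n A C) (Y : EndedComplex n B C)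
    (f : X.cx ⟶ Y.cx) {W : 𝒞} (r : (cocone X Y f).cx.X 1 ⟶ W) :
    ∃ (r₁ : X.cx.X 1 ⟶ W) (r₂ : Y.cx.X 0 ⟶ W),
      (cocone X Y f).dFirst ≫ r = X.dFirst ≫ r₁ + (X.left.hom ≫ f.f 0) ≫ r₂ := by
  let r' : cut (0 < n) (X.cx.X 1) ⊞ cut (0 ≤ n) (Y.cx.X 0) ⟶ W := r
  have hd : (cocone X Y f).dFirst = X.left.hom ≫
      biprod.lift (X.cx.d 0 1 ≫ cutIn (0 < n) _) (f.f 0 ≫ cutIn (0 ≤ n) _) :=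
    congrArg (X.left.hom ≫ ·) (CochainComplex.of_d (coconeX X Y) (coconeD X Y f) 0)
  refine ⟨cutIn _ _ ≫ biprod.inl ≫ r', cutIn _ _ ≫ biprod.inr ≫ r', ?_⟩
  have hr : (cocone X Y f).dFirst ≫ r = (X.left.hom ≫
      biprod.lift (X.cx.d 0 1 ≫ cutIn (0 < n) _) (f.f 0 ≫ cutIn (0 ≤ n) _)) ≫ r' := by
    rw [hd]; rfl
  rw [hr, dFirst]
  simp only [← Category.assoc, ← Preadditive.add_comp]
  congr 1
  apply biprod.hom_ext <;> simp

/-- Morphisms into the last term `Xₙ₊₁ ⊞ Yₙ` of a cone, in components. -/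
theorem exists_comp_cone_dLast (hn : 1 ≤ n) {A C D : 𝒞} (X : EndedComplex n A C)
    (Y : EndedComplex n A D) (f : X.cx ⟶ Y.cx) {W : 𝒞} (s : W ⟶ (cone X Y f).cx.X n) :
    ∃ (s₁ : W ⟶ X.cx.X (n + 1)) (s₂ : W ⟶ Y.cx.X n),
      s ≫ (cone X Y f).dLast = s₁ ≫ f.f (n + 1) ≫ Y.right.hom + s₂ ≫ Y.dLast := by
  obtain ⟨n, rfl⟩ := Nat.exists_eq_succ_of_ne_zero (by omega : n ≠ 0)
  let s' : W ⟶ X.cx.X (n + 2) ⊞ Y.cx.X (n + 1) := s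
  have hd : (cone X Y f).dLast =
      biprod.desc (biprod.lift (-X.cx.d (n + 2) (n + 3)) (f.f (n + 2)))
        (biprod.lift 0 (Y.cx.d (n + 1) (n + 2))) ≫ biprod.snd ≫ Y.right.hom := by
    simp only [dLast, cone]
    rw [CochainComplex.of_d]
    rfl
  refine ⟨s' ≫ biprod.fst, s' ≫ biprod.snd, ?_⟩
  have hs : s ≫ (cone X Y f).dLast = s' ≫
      biprod.desc (biprod.lift (-X.cx.d (n + 2) (n + 3)) (f.f (n + 2)))
        (biprod.lift 0 (Y.cx.d (n + 1) (n + 2))) ≫ biprod.snd ≫ Y.right.hom := by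
    rw [hd]; rfl
  rw [hs, dLast]
  simp only [Category.assoc, ← Preadditive.comp_add]
  congr 1
  apply biprod.hom_ext' <;> simp

end EndedComplex

end Ends

section Lifting

variable {k : Type u} [CommRing k] {𝒞 : Type uC} [Category.{v} 𝒞] [Preadditive 𝒞]
variable {E : 𝒞ᵒᵖ ⥤ 𝒞 ⥤ ModuleCat.{w} k}

theorem push_comp_apply (Z : 𝒞) {A B C : 𝒞} (f : A ⟶ B) (g : B ⟶ C) (x : Ext E Z A) :
    push E Z (f ≫ g) x = push E Z g (push E Z f x) := by
  rw [push_comp]; rfl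

theorem pull_comp_apply {A B C : 𝒞} (f : A ⟶ B) (g : B ⟶ C) {Z : 𝒞} (x : Ext E C Z) :
    pull E (f ≫ g) Z x = pull E f Z (pull E g Z x) := by
  rw [pull_comp]; rfl

@[simp]
theorem push_id_apply (Z A : 𝒞) (x : Ext E Z A) : push E Z (𝟙 A) x = x := by simp [push]

@[simp]
theorem pull_id_apply (Z A : 𝒞) (x : Ext E Z A) : pull E (𝟙 Z) A x = x := by simp [pull]

theorem pull_push_apply {A B C D : 𝒞} (c : C ⟶ D) (a : A ⟶ B) (x : Ext E D A) :
    pull E c B (push E D a x) = push E C a (pull E c A x) :=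
  congrArg (fun f => f.hom x) ((E.map c.op).naturality a)

variable [Linear k 𝒞] [IsBilinear E]

@[simp]
theorem push_zero_apply (Z A B : 𝒞) (x : Ext E Z A) : push E Z (0 : A ⟶ B) x = 0 :=
  LinearMap.congr_fun (map_zero (pushHom E A B Z)) x

@[simp]
theorem pull_zero_apply (Z A B : 𝒞) (x : Ext E B Z) : pull E (0 : A ⟶ B) Z x = 0 :=
  LinearMap.congr_fun (map_zero (pullHom E A B Z)) x

theorem push_add_apply (Z : 𝒞) {A B : 𝒞} (f g : A ⟶ B) (x : Ext E Z A) :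
    push E Z (f + g) x = push E Z f x + push E Z g x := by
  rw [IsBilinear.push_add]; rfl

theorem pull_add_apply {A B : 𝒞} (f g : A ⟶ B) {Z : 𝒞} (x : Ext E B Z) :
    pull E (f + g) Z x = pull E f Z x + pull E g Z x := by
  rw [IsBilinear.pull_add]; rfl

theorem push_sum_apply (Z : 𝒞) {A B : 𝒞} {ι : Type*} (s : Finset ι) (f : ι → (A ⟶ B))
    (x : Ext E Z A) : push E Z (∑ i ∈ s, f i) x = ∑ i ∈ s, push E Z (f i) x := by
  have := LinearMap.congr_fun (map_sum (pushHom E A B Z) f s) x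
  rwa [LinearMap.sum_apply] at this

theorem pull_sum_apply {A B : 𝒞} {ι : Type*} (s : Finset ι) (f : ι → (A ⟶ B)) {Z : 𝒞}
    (x : Ext E B Z) : pull E (∑ i ∈ s, f i) Z x = ∑ i ∈ s, pull E (f i) Z x := by
  have := LinearMap.congr_fun (map_sum (pullHom E A B Z) f s) x
  rwa [LinearMap.sum_apply] at this

variable [HasFiniteBiproducts 𝒞] {n : ℕ}

theorem NExangulated.exists_realizes (S : NExangulated E n) {A C : 𝒞} (δ : Ext E C A) :
    ∃ X : EndedComplex n A C, Realizes S.s δ X := by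
  obtain ⟨X, hX⟩ := Quotient.exists_rep (S.s δ)
  exact ⟨X, hX.symm⟩

/-- If every morphism killing `μ ∈ 𝔼(C, B)` also kills `δ ∈ 𝔼(C, A)`, then `δ` is a pushforward
of `μ`. This is the exactness of `𝒞(B, A) ⟶ 𝔼(C, A) ⟶ 𝔼(Xₙ, A)` for a conflation `X` of `μ`:
in a good lift of the projection `B ⊞ A ⟶ B` the cocone realizes `0`, hence starts with a split
monomorphism, which expresses the extension `(μ, δ)` through `μ`. -/
theorem NExangulated.exists_push_eq (S : NExangulated E n) {A B C : 𝒞}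
    (μ : Ext E C B) (δ : Ext E C A)
    (h : ∀ (W : 𝒞) (g : W ⟶ C), pull E g B μ = 0 → pull E g A δ = 0) :
    ∃ a : B ⟶ A, push E C a μ = δ := by
  -- The extension with components `μ` and `δ`.
  let ρ : Ext E C (B ⊞ A) := push E C biprod.inl μ + push E C biprod.inr δ
  have hρ₁ : push E C biprod.fst ρ = μ := by
    simp only [ρ, map_add, ← push_comp_apply]; simp
  have hρ₂ : push E C biprod.snd ρ = δ := by
    simp only [ρ, map_add, ← push_comp_apply]; simp
  obtain ⟨X, hX⟩ := S.exists_realizes ρ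
  obtain ⟨Y, hY⟩ := S.exists_realizes (push E C biprod.fst ρ)
  obtain ⟨f, hf, hcone⟩ := S.exists_good_lift_op ρ biprod.fst X Y hX hY
  have hXe := S.isNExangle _ _ hX
  have hYe := S.isNExangle _ _ hY
  have hYμ := hYe.pull_dLast
  rw [hρ₁] at hYμ
  have h0 : pull E Y.dLast _ ρ = 0 := by
    simp only [ρ, map_add, pull_push_apply]
    rw [hYμ, h _ _ hYμ]
    simp
  obtain ⟨r, hr⟩ := (S.isNExangle _ _ hcone).exact_right_first _ (𝟙 _) (by simpa using h0)
  obtain ⟨r₁, r₂, hr'⟩ := X.exists_cocone_dFirst_comp Y f r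
  rw [hr, hf.left] at hr'
  refine ⟨Y.left.hom ≫ r₂ ≫ biprod.snd, ?_⟩
  have key := congrArg (fun t => push E C t ρ) hr'
  simp only [push_add_apply, Category.assoc] at key
  rw [push_comp_apply _ X.dFirst, hXe.push_dFirst, map_zero, zero_add, push_comp_apply, hρ₁,
    push_id_apply] at key
  rw [← hρ₂, key, ← push_comp_apply, Category.assoc]

/-- If every morphism killing `μ ∈ 𝔼(C, A)` also kills `δ ∈ 𝔼(D, A)`, then `δ` is a pullback of
`μ`. This is the exactness of `𝒞(D, C) ⟶ 𝔼(D, A) ⟶ 𝔼(D, X₁)` for a conflation `X` of `μ`. -/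
theorem NExangulated.exists_pull_eq (S : NExangulated E n) (hn : 1 ≤ n) {A C D : 𝒞}
    (μ : Ext E C A) (δ : Ext E D A)
    (h : ∀ (W : 𝒞) (f : A ⟶ W), push E C f μ = 0 → push E D f δ = 0) :
    ∃ c : D ⟶ C, pull E c A μ = δ := by
  let ρ : Ext E (C ⊞ D) A := pull E biprod.fst A μ + pull E biprod.snd A δ
  have hρ₁ : pull E biprod.inl A ρ = μ := by
    simp only [ρ, map_add, ← pull_comp_apply]; simp
  have hρ₂ : pull E biprod.inr A ρ = δ := by
    simp only [ρ, map_add, ← pull_comp_apply]; simp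
  obtain ⟨X, hX⟩ := S.exists_realizes (pull E biprod.inl A ρ)
  obtain ⟨Y, hY⟩ := S.exists_realizes ρ
  obtain ⟨f, hf, hcone⟩ := S.exists_good_lift ρ biprod.inl X Y hX hY
  have hXe := S.isNExangle _ _ hX
  have hYe := S.isNExangle _ _ hY
  have hXμ := hXe.push_dFirst
  rw [hρ₁] at hXμ
  have h0 : push E _ X.dFirst ρ = 0 := by
    simp only [ρ, map_add, ← pull_push_apply]
    rw [hXμ, h _ _ hXμ]
    simp
  obtain ⟨s, hs⟩ := (S.isNExangle _ _ hcone).exact_left_last _ (𝟙 _) (by simpa using h0)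
  obtain ⟨s₁, s₂, hs'⟩ := X.exists_comp_cone_dLast hn Y f s
  rw [hs, hf.right] at hs'
  refine ⟨biprod.inr ≫ s₁ ≫ X.right.hom, ?_⟩
  have key := congrArg (fun t => pull E t A ρ) hs'
  simp only [pull_add_apply, ← Category.assoc] at key
  rw [pull_comp_apply _ Y.dLast, hYe.pull_dLast, map_zero, add_zero, pull_comp_apply _ biprod.inl,
    hρ₁, pull_id_apply] at key
  rw [← hρ₂, key, ← pull_comp_apply]

end Lifting

/-! ### Objects with local endomorphism rings -/

section Local

variable {𝒞 : Type uC} [Category.{v} 𝒞] [Preadditive 𝒞]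

theorem isUnit_end_iff {X : 𝒞} (f : X ⟶ X) : IsUnit (End.of f) ↔ IsIso f :=
  CategoryTheory.isUnit_iff_isIso f

/-- In a local endomorphism ring one of two morphisms with sum `𝟙` is invertible. -/
theorem isIso_or_isIso_of_add {X : 𝒞} [IsLocalRing (End X)] {f g : X ⟶ X} (h : f + g = 𝟙 X) :
    IsIso f ∨ IsIso g := by
  rw [← isUnit_end_iff, ← isUnit_end_iff]
  exact IsLocalRing.isUnit_or_isUnit_of_add_one (R := End X) h

theorem id_ne_zero_of_isLocalRing (X : 𝒞) [IsLocalRing (End X)] : 𝟙 X ≠ 0 :=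
  one_ne_zero (α := End X)

/-- An endomorphism ring is local as soon as every pair with sum `𝟙` contains an isomorphism. -/
theorem isLocalRing_end {X : 𝒞} (h0 : 𝟙 X ≠ 0)
    (h : ∀ f g : X ⟶ X, f + g = 𝟙 X → IsIso f ∨ IsIso g) : IsLocalRing (End X) :=
  { exists_pair_ne := ⟨𝟙 X, 0, h0⟩
    isUnit_or_isUnit_of_add_one := fun {a b} hab => by
      exact (h a b hab).imp (isUnit_end_iff _).2 (isUnit_end_iff _).2 }

theorem eq_id_of_idempotent {X : 𝒞} [IsLocalRing (End X)] {e : X ⟶ X} (he : e ≫ e = e)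
    (h0 : e ≠ 0) : e = 𝟙 X := by
  rcases isIso_or_isIso_of_add (show e + (𝟙 X - e) = 𝟙 X by abel) with h | h
  · rw [← cancel_epi e, he, Category.comp_id]
  · refine absurd ?_ h0
    rw [← cancel_mono (𝟙 X - e)]
    simp [he]

/-- Between objects with local endomorphism rings, a morphism with invertible composite
`f ≫ g` is an isomorphism. -/
theorem isIso_of_isIso_comp {X Y : 𝒞} [IsLocalRing (End X)] [IsLocalRing (End Y)] (f : X ⟶ Y)
    (g : Y ⟶ X) (h : IsIso (f ≫ g)) : IsIso f := by
  have he : g ≫ inv (f ≫ g) ≫ f = 𝟙 Y := by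
    refine eq_id_of_idempotent ?_ fun h0 => id_ne_zero_of_isLocalRing X ?_
    · have : f ≫ g ≫ inv (f ≫ g) = 𝟙 X := by rw [← Category.assoc, IsIso.hom_inv_id]
      simp [reassoc_of% this]
    · have h1 : f ≫ (g ≫ inv (f ≫ g) ≫ f) ≫ g = f ≫ g := by simp
      rw [h0, zero_comp, comp_zero] at h1
      have h2 : (f ≫ g) ≫ inv (f ≫ g) = 0 := by
        generalize inv (f ≫ g) = t
        rw [← h1, zero_comp]
      rwa [IsIso.hom_inv_id] at h2
  exact ⟨g ≫ inv (f ≫ g), by rw [← Category.assoc, IsIso.hom_inv_id], by simpa using he⟩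

/-- A full additive functor carries objects with local endomorphism rings to such objects, or
to zero. -/
theorem isLocalRing_end_map {𝒟 : Type*} [Category* 𝒟] [Preadditive 𝒟] (F : 𝒞 ⥤ 𝒟) [F.Additive]
    [F.Full] (X : 𝒞) [IsLocalRing (End X)] (h0 : 𝟙 (F.obj X) ≠ 0) :
    IsLocalRing (End (F.obj X)) := by
  refine isLocalRing_end h0 fun f g hfg => ?_
  obtain ⟨f, rfl⟩ := F.map_surjective f
  have hg : g = F.map (𝟙 X - f) := by simp [← hfg]
  subst hg
  rcases isIso_or_isIso_of_add (show f + (𝟙 X - f) = 𝟙 X by abel) with h | h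
  · exact Or.inl inferInstance
  · exact Or.inr inferInstance

theorem isLocalRing_end_of_iso {X Y : 𝒞} [IsLocalRing (End X)] (e : X ≅ Y) :
    IsLocalRing (End Y) := by
  refine isLocalRing_end (fun h0 => id_ne_zero_of_isLocalRing X ?_) fun f g hfg => ?_
  · rw [← e.hom_inv_id, ← Category.id_comp e.inv, h0, zero_comp, comp_zero]
  · have : (e.hom ≫ f ≫ e.inv) + (e.hom ≫ g ≫ e.inv) = 𝟙 _ := by
      rw [← Preadditive.comp_add, ← Preadditive.add_comp, hfg]
      simp
    rcases isIso_or_isIso_of_add this with h | h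
    · have := IsIso.of_isIso_comp_left e.hom (f ≫ e.inv)
      exact Or.inl (IsIso.of_isIso_comp_right f e.inv)
    · have := IsIso.of_isIso_comp_left e.hom (g ≫ e.inv)
      exact Or.inr (IsIso.of_isIso_comp_right g e.inv)

end Local

/-! ### Finite direct sum decompositions -/

section Decomposition

variable {𝒞 : Type uC} [Category.{v} 𝒞] [Preadditive 𝒞]

/-- Inclusions and projections exhibiting `X` as the direct sum of a finite family `Y`. -/
structure SumData {J : Type} [Fintype J] (Y : J → 𝒞) (X : 𝒞) where
  ι : ∀ j, Y j ⟶ X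
  π : ∀ j, X ⟶ Y j
  ι_π_self : ∀ j, ι j ≫ π j = 𝟙 (Y j)
  ι_π_ne : ∀ i j, i ≠ j → ι i ≫ π j = 0
  total : ∑ j, π j ≫ ι j = 𝟙 X

namespace SumData

variable {J : Type} [Fintype J] {Y : J → 𝒞} {X : 𝒞}

attribute [simp] ι_π_self

theorem comp_total (D : SumData Y X) {W : 𝒞} (f : W ⟶ X) : ∑ j, (f ≫ D.π j) ≫ D.ι j = f := by
  simp only [Category.assoc, ← Preadditive.comp_sum, D.total, Category.comp_id]

theorem total_comp (D : SumData Y X) {W : 𝒞} (f : X ⟶ W) : ∑ j, D.π j ≫ D.ι j ≫ f = f := by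
  simp only [← Category.assoc, ← Preadditive.sum_comp, D.total, Category.id_comp]

theorem ι_comp_sum (D : SumData Y X) {W : 𝒞} (f : ∀ j, Y j ⟶ W) (j : J) :
    D.ι j ≫ ∑ i, D.π i ≫ f i = f j := by
  classical
  rw [Preadditive.comp_sum, Finset.sum_eq_single j]
  · rw [← Category.assoc, D.ι_π_self, Category.id_comp]
  · intro i _ hij
    rw [← Category.assoc, D.ι_π_ne _ _ hij.symm, zero_comp]
  · simp

theorem sum_comp_π (D : SumData Y X) {W : 𝒞} (f : ∀ j, W ⟶ Y j) (j : J) :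
    (∑ i, f i ≫ D.ι i) ≫ D.π j = f j := by
  classical
  rw [Preadditive.sum_comp, Finset.sum_eq_single j]
  · rw [Category.assoc, D.ι_π_self, Category.comp_id]
  · intro i _ hij
    rw [Category.assoc, D.ι_π_ne _ _ hij, comp_zero]
  · simp

/-- The decomposition of a biproduct, transported along an isomorphism. -/
def ofIso [HasFiniteBiproducts 𝒞] (e : X ≅ ⨁ Y) : SumData Y X where
  ι j := biproduct.ι Y j ≫ e.inv
  π j := e.hom ≫ biproduct.π Y j
  ι_π_self j := by simp
  ι_π_ne i j h := by simp [biproduct.ι_π_ne Y h]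
  total := by
    have : ∀ j, (e.hom ≫ biproduct.π Y j) ≫ biproduct.ι Y j ≫ e.inv =
        e.hom ≫ (biproduct.π Y j ≫ biproduct.ι Y j) ≫ e.inv := by simp
    simp only [this, ← Preadditive.comp_sum, ← Preadditive.sum_comp, biproduct.total]
    simp

/-- If an additive functor sends `X` to an object with local endomorphism ring, then some summand of
`X` already has the same image. -/
theorem exists_iso_map (D : SumData Y X) {𝒟 : Type*} [Category* 𝒟] [Preadditive 𝒟] (F : 𝒞 ⥤ 𝒟)
    [F.Additive] [IsLocalRing (End (F.obj X))] : ∃ j, Nonempty (F.obj (Y j) ≅ F.obj X) := by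
  classical
  by_contra hcon
  have hne : ∀ j, ¬ IsIso (F.map (D.π j) ≫ F.map (D.ι j)) := by
    intro j hj
    have : IsIso (F.map (D.ι j)) := by
      have : IsSplitMono (F.map (D.ι j)) :=
        ⟨⟨⟨F.map (D.π j), by rw [← F.map_comp, D.ι_π_self, F.map_id]⟩⟩⟩
      have : IsSplitEpi (F.map (D.ι j)) :=
        ⟨⟨⟨inv (F.map (D.π j) ≫ F.map (D.ι j)) ≫ F.map (D.π j), by simp⟩⟩⟩
      exact isIso_of_mono_of_isSplitEpi _
    exact hcon ⟨j, ⟨asIso (F.map (D.ι j))⟩⟩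
  have hsum : ∀ s : Finset J, ¬ IsIso (∑ j ∈ s, F.map (D.π j) ≫ F.map (D.ι j)) := by
    intro s
    induction s using Finset.induction_on with
    | empty =>
      intro h
      refine id_ne_zero_of_isLocalRing (F.obj X) ?_
      rw [Finset.sum_empty] at h
      rw [← IsIso.hom_inv_id (0 : F.obj X ⟶ F.obj X), zero_comp]
    | insert j s hj ih =>
      intro h
      rw [Finset.sum_insert hj] at h
      rcases isIso_or_isIso_of_add (f := F.map (D.π j) ≫ F.map (D.ι j) ≫ inv (_ + _))
        (g := (∑ j ∈ s, F.map (D.π j) ≫ F.map (D.ι j)) ≫ inv (_ + _))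
        (by rw [← Category.assoc, ← Preadditive.add_comp]; exact IsIso.hom_inv_id _) with h' | h'
      · rw [← Category.assoc] at h'
        exact hne j (IsIso.of_isIso_comp_right _ (inv (F.map (D.π j) ≫ F.map (D.ι j) +
          ∑ j ∈ s, F.map (D.π j) ≫ F.map (D.ι j))))
      · exact ih (IsIso.of_isIso_comp_right _ (inv (F.map (D.π j) ≫ F.map (D.ι j) +
          ∑ j ∈ s, F.map (D.π j) ≫ F.map (D.ι j))))
  apply hsum Finset.univ
  have : ∑ j, F.map (D.π j) ≫ F.map (D.ι j) = 𝟙 _ := by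
    simp only [← F.map_comp, ← F.map_sum, D.total, F.map_id]
  rw [this]
  infer_instance

end SumData

variable [HasFiniteBiproducts 𝒞]

theorem indecomposable_of_isLocalRing (X : 𝒞) [IsLocalRing (End X)] : Indecomposable X := by
  refine ⟨fun h => id_ne_zero_of_isLocalRing X (h.eq_of_src _ _), fun Y Z e => ?_⟩
  have hadd : e.hom ≫ biprod.fst ≫ biprod.inl ≫ e.inv +
      e.hom ≫ biprod.snd ≫ biprod.inr ≫ e.inv = 𝟙 X := by
    rw [← Preadditive.comp_add, ← Category.assoc, ← Category.assoc, ← Preadditive.add_comp,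
      biprod.total]
    simp
  -- The invertible one of the two idempotents is the identity, so that the other one vanishes.
  rcases isIso_or_isIso_of_add hadd with h | h
  · right
    have h1 : (biprod.inr : Z ⟶ Y ⊞ Z) ≫ e.inv = 0 := by
      rw [← cancel_mono (e.hom ≫ biprod.fst ≫ biprod.inl ≫ e.inv)]
      simp
    rw [IsZero.iff_id_eq_zero]
    have : (biprod.inr ≫ e.inv) ≫ e.hom ≫ biprod.snd = 𝟙 Z := by simp
    rw [← this, h1, zero_comp]
  · left
    have h1 : (biprod.inl : Y ⟶ Y ⊞ Z) ≫ e.inv = 0 := by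
      rw [← cancel_mono (e.hom ≫ biprod.snd ≫ biprod.inr ≫ e.inv)]
      simp
    rw [IsZero.iff_id_eq_zero]
    have : (biprod.inl ≫ e.inv) ≫ e.hom ≫ biprod.fst = 𝟙 Y := by simp
    rw [← this, h1, zero_comp]

theorem IsKrullSchmidt.exists_sumData (hKS : IsKrullSchmidt 𝒞) (X : 𝒞) :
    ∃ (m : ℕ) (Y : Fin m → 𝒞), (∀ i, IsLocalRing (End (Y i))) ∧ Nonempty (SumData Y X) := by
  obtain ⟨m, Y, hY, ⟨e⟩⟩ := hKS X
  exact ⟨m, Y, hY, ⟨SumData.ofIso e⟩⟩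

theorem IsKrullSchmidt.isLocalRing_end (hKS : IsKrullSchmidt 𝒞) {X : 𝒞} (hX : Indecomposable X) :
    IsLocalRing (End X) := by
  classical
  obtain ⟨m, Y, hY, ⟨D⟩⟩ := hKS.exists_sumData X
  obtain _ | m := m
  · refine absurd ?_ hX.1
    rw [IsZero.iff_id_eq_zero, ← D.total]
    simp
  let i : Fin (m + 1) := 0
  -- Splitting off one summand leaves a zero complement, as `X` is indecomposable.
  let Z := ⨁ fun j : {j // j ≠ i} => Y j
  have tot : D.π i ≫ D.ι i + ∑ j : {j // j ≠ i}, D.π j.1 ≫ D.ι j.1 = 𝟙 X := by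
    rw [← D.total, ← Finset.add_sum_erase Finset.univ _ (Finset.mem_univ i)]
    congr 1
    symm
    exact Finset.sum_subtype _ (by simp) _
  let e : X ≅ Y i ⊞ Z :=
    { hom := biprod.lift (D.π i) (biproduct.lift fun j => D.π j.1)
      inv := biprod.desc (D.ι i) (biproduct.desc fun j => D.ι j.1)
      hom_inv_id := by
        rw [biprod.lift_desc, biproduct.lift_desc]
        exact tot
      inv_hom_id := by
        apply biprod.hom_ext <;> apply biprod.hom_ext'
        · simp
        · simp only [biprod.inr_desc_assoc, Category.assoc, biprod.lift_fst]
          refine biproduct.hom_ext' _ _ fun j => ?_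
          simp [D.ι_π_ne _ _ j.2]
        · simp only [biprod.inl_desc_assoc, Category.assoc, biprod.lift_snd]
          refine biproduct.hom_ext _ _ fun j => ?_
          simp [D.ι_π_ne _ _ j.2.symm]
        · simp only [biprod.inr_desc_assoc, Category.assoc, biprod.lift_snd]
          refine biproduct.hom_ext' _ _ fun j => biproduct.hom_ext _ _ fun l => ?_
          by_cases h : j = l
          · subst h
            simp [Z]
          · have h0 : biproduct.ι (fun j : {j // j ≠ i} => Y j) j ≫ 𝟙 Z ≫
                biproduct.π (fun j : {j // j ≠ i} => Y j) l = 0 := by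
              rw [Category.id_comp, biproduct.ι_π_ne _ h]
            simp [D.ι_π_ne _ _ (fun h' => h (Subtype.ext h')), h0] }
  have := hY i
  rcases hX.2 _ _ e with h | h
  · exact absurd (h.eq_of_src _ _) (id_ne_zero_of_isLocalRing (Y i))
  · have hZ : ∀ j : {j // j ≠ i}, D.π j.1 = 0 := fun j => by
      have : D.π j.1 = biproduct.lift (fun j : {j // j ≠ i} => D.π j.1) ≫ biproduct.π _ j := by
        simp
      rw [this, h.eq_of_tgt (biproduct.lift fun j : {j // j ≠ i} => D.π j.1) 0, zero_comp]
    have hi : D.π i ≫ D.ι i = 𝟙 X := by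
      rw [← tot, Finset.sum_eq_zero fun j _ => by rw [hZ j, zero_comp], add_zero]
    have : IsIso (D.ι i) := ⟨D.π i, D.ι_π_self i, hi⟩
    exact isLocalRing_end_of_iso (asIso (D.ι i))

end Decomposition

/-! ### The radical of a Krull–Schmidt category -/

section Radical

variable {𝒞 : Type uC} [Category.{v} 𝒞] [Preadditive 𝒞]

namespace InRadical

variable {A B C : 𝒞}

theorem zero : InRadical (0 : A ⟶ B) := fun g => by
  rw [zero_comp, sub_zero]; infer_instance

theorem comp_right {f : A ⟶ B} (hf : InRadical f) (y : B ⟶ C) : InRadical (f ≫ y) := fun g => by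
  rw [Category.assoc]; exact hf _

theorem comp_left {f : B ⟶ C} (hf : InRadical f) (x : A ⟶ B) : InRadical (x ≫ f) := fun g => by
  have := hf (g ≫ x)
  -- The inverse of `1 - ab` is `1 + a (1 - ba)⁻¹ b`.
  have h₁ := IsIso.hom_inv_id (𝟙 B - f ≫ g ≫ x)
  have h₂ := IsIso.inv_hom_id (𝟙 B - f ≫ g ≫ x)
  generalize inv (𝟙 B - f ≫ g ≫ x) = t at h₁ h₂
  simp only [Preadditive.sub_comp, Preadditive.comp_sub, Category.id_comp, Category.comp_id,
    Category.assoc] at h₁ h₂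
  refine ⟨𝟙 A + x ≫ t ≫ f ≫ g, ?_, ?_⟩
  · have h : x ≫ (t - f ≫ g ≫ x ≫ t) ≫ f ≫ g = x ≫ f ≫ g := by rw [h₁, Category.id_comp]
    simp only [Preadditive.sub_comp, Preadditive.comp_sub, Category.assoc] at h
    simp only [Preadditive.sub_comp, Preadditive.comp_add, Category.id_comp, Category.comp_id,
      Category.assoc]
    rw [← sub_eq_zero] at h ⊢
    rw [← h]
    abel
  · have h : x ≫ (t - t ≫ f ≫ g ≫ x) ≫ f ≫ g = x ≫ f ≫ g := by rw [h₂, Category.id_comp]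
    simp only [Preadditive.sub_comp, Preadditive.comp_sub, Category.assoc] at h
    simp only [Preadditive.add_comp, Preadditive.comp_sub, Category.id_comp, Category.comp_id,
      Category.assoc]
    rw [← sub_eq_zero] at h ⊢
    rw [← h]
    abel

theorem add {f g : A ⟶ B} (hf : InRadical f) (hg : InRadical g) : InRadical (f + g) := fun h => by
  have := hf h
  have h' := hg.comp_left (inv (𝟙 A - f ≫ h)) h
  have e : 𝟙 A - (f + g) ≫ h = (𝟙 A - f ≫ h) ≫ (𝟙 A - (inv (𝟙 A - f ≫ h) ≫ g) ≫ h) := by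
    rw [Preadditive.comp_sub, Category.comp_id, Category.assoc, IsIso.hom_inv_id_assoc,
      Preadditive.add_comp]
    abel
  rw [e]
  infer_instance

theorem sum {J : Type*} (s : Finset J) {f : J → (A ⟶ B)} (hf : ∀ j ∈ s, InRadical (f j)) :
    InRadical (∑ j ∈ s, f j) := by
  classical
  induction s using Finset.induction_on with
  | empty => exact zero
  | insert j s hj ih =>
    rw [Finset.sum_insert hj]
    exact (hf j (by simp)).add (ih fun i hi => hf i (by simp [hi]))

theorem of_not_isIso [IsLocalRing (End A)] [IsLocalRing (End B)] {f : A ⟶ B} (hf : ¬IsIso f) :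
    InRadical f := fun g =>
  (isIso_or_isIso_of_add (show f ≫ g + (𝟙 A - f ≫ g) = 𝟙 A by abel)).resolve_left
    fun h => hf (isIso_of_isIso_comp f g h)

end InRadical

/-- A morphism outside the radical has an invertible component between indecomposable summands. -/
theorem exists_isIso_component {J K : Type} [Fintype J] [Fintype K] {Y : J → 𝒞} {Z : K → 𝒞}
    {P Q : 𝒞} (D : SumData Y P) (F : SumData Z Q) (hY : ∀ j, IsLocalRing (End (Y j)))
    (hZ : ∀ j, IsLocalRing (End (Z j))) (f : P ⟶ Q) (hf : ¬InRadical f) :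
    ∃ j l, IsIso (D.ι j ≫ f ≫ F.π l) := by
  by_contra! hcon
  refine hf ?_
  rw [← D.total_comp f]
  refine InRadical.sum _ fun j _ => InRadical.comp_left ?_ _
  rw [← F.comp_total (D.ι j ≫ f)]
  refine InRadical.sum _ fun l _ => InRadical.comp_right ?_ _
  rw [Category.assoc]
  exact InRadical.of_not_isIso (hcon j l)

end Radical

/-! ### Minimal realizations -/

section Minimal

variable {𝒞 : Type uC} [Category.{v} 𝒞] [Preadditive 𝒞]

namespace EndedComplex

variable {n : ℕ} {A C : 𝒞}

/-- An endomorphism of a complex which is homotopic to the identity, is the identity at both ends,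
and is split by objects `Zⱼ` in each degree, exhibits a homotopy equivalent complex on the `Zⱼ`. -/
theorem exists_htpyEquiv_of_splitting (X : EndedComplex n A C) (f : X.cx ⟶ X.cx)
    (hf : Homotopy f (𝟙 X.cx)) (h0 : f.f 0 = 𝟙 _) (hn : f.f (n + 1) = 𝟙 _) (Z : ℕ → 𝒞)
    (r : ∀ j, X.cx.X j ⟶ Z j) (s : ∀ j, Z j ⟶ X.cx.X j) (hsr : ∀ j, s j ≫ r j = 𝟙 _)
    (hrs : ∀ j, r j ≫ s j = f.f j) :
    ∃ X' : EndedComplex n A C, HtpyEquiv X X' ∧ ∀ j, X'.cx.X j = Z j := by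
  let K : CochainComplex 𝒞 ℕ :=
    { X := Z
      d := fun i j => s i ≫ X.cx.d i j ≫ r j
      shape := fun i j h => by rw [X.cx.shape i j h]; simp
      d_comp_d' := fun i j k _ _ => by
        have : (s i ≫ X.cx.d i j ≫ r j) ≫ s j ≫ X.cx.d j k ≫ r k =
            s i ≫ X.cx.d i j ≫ (r j ≫ s j) ≫ X.cx.d j k ≫ r k := by simp
        rw [this, hrs]
        simp }
  let ρ : X.cx ⟶ K :=
    { f := r
      comm' := fun i j _ => by
        change r i ≫ s i ≫ X.cx.d i j ≫ r j = X.cx.d i j ≫ r j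
        have h1 : f.f j ≫ r j = r j := by rw [← hrs, Category.assoc, hsr, Category.comp_id]
        rw [← Category.assoc (r i), hrs, f.comm_assoc, h1] }
  let σ : K ⟶ X.cx :=
    { f := s
      comm' := fun i j _ => by
        change s i ≫ X.cx.d i j = (s i ≫ X.cx.d i j ≫ r j) ≫ s j
        have h1 : s i ≫ f.f i = s i := by rw [← hrs, ← Category.assoc, hsr, Category.id_comp]
        rw [Category.assoc, Category.assoc, hrs, ← f.comm, ← Category.assoc, h1] }
  have hρσ : ρ ≫ σ = f := by ext j; exact hrs j
  have hσρ : σ ≫ ρ = 𝟙 K := by ext j; exact hsr j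
  let X' : EndedComplex n A C :=
    { cx := K
      isZero := fun i hi => by
        rw [IsZero.iff_id_eq_zero]
        change 𝟙 (Z i) = 0
        rw [← hsr i, (X.isZero i hi).eq_of_src (r i) 0, comp_zero]
      left := X.left ≪≫ ⟨r 0, s 0, by rw [hrs, h0], hsr 0⟩
      right := Iso.trans ⟨s (n + 1), r (n + 1), hsr _, by rw [hrs, hn]⟩ X.right }
  refine ⟨X', ⟨ρ, σ, ⟨?_, ?_⟩, ⟨?_, ?_⟩, ⟨?_⟩, ⟨?_⟩⟩, fun _ => rfl⟩
  · simp [X', ρ]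
  · change r (n + 1) ≫ s (n + 1) ≫ X.right.hom = X.right.hom ≫ 𝟙 C
    rw [← Category.assoc, hrs, hn, Category.id_comp, Category.comp_id]
  · change (X.left.hom ≫ r 0) ≫ s 0 = 𝟙 A ≫ X.left.hom
    rw [Category.assoc, hrs, h0, Category.comp_id, Category.id_comp]
  · change s (n + 1) ≫ X.right.hom = (s (n + 1) ≫ X.right.hom) ≫ 𝟙 C
    rw [Category.comp_id]
  · rw [hρσ]; exact hf
  · rw [hσρ]

/-- A morphism `h : Xᵢ₊₁ ⟶ Xᵢ` defines an endomorphism `1 + dh + hd` homotopic to `1`. -/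
theorem exists_homotopy_id (X : EndedComplex n A C) (i : ℕ) (hi : 1 ≤ i)
    (h : X.cx.X (i + 1) ⟶ X.cx.X i) :
    ∃ f : X.cx ⟶ X.cx, Nonempty (Homotopy f (𝟙 X.cx)) ∧
      f.f i = 𝟙 _ + X.cx.d i (i + 1) ≫ h ∧ f.f (i + 1) = 𝟙 _ + h ≫ X.cx.d i (i + 1) ∧
      ∀ j, j ≠ i → j ≠ i + 1 → f.f j = 𝟙 _ := by
  let H : ∀ a b, X.cx.X a ⟶ X.cx.X b := fun a b =>
    if hab : a = i + 1 ∧ b = i then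
      eqToHom (by rw [hab.1]) ≫ h ≫ eqToHom (by rw [hab.2]) else 0
  have H_eq : H (i + 1) i = h := by simp [H]
  have H_ne : ∀ a b, ¬(a = i + 1 ∧ b = i) → H a b = 0 := fun a b hab => dif_neg hab
  have hom : Homotopy (Homotopy.nullHomotopicMap H) 0 := Homotopy.nullHomotopy H
    fun a b hab => H_ne a b fun h => hab (by simp [h.1, h.2])
  have hval : ∀ a b c : ℕ, a + 1 = b → b + 1 = c → (Homotopy.nullHomotopicMap H).f b =
      X.cx.d b c ≫ H c b + H b a ≫ X.cx.d a b := fun a b c hab hbc =>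
    Homotopy.nullHomotopicMap_f (c := ComplexShape.up ℕ) hab hbc H
  refine ⟨𝟙 _ + Homotopy.nullHomotopicMap H, ⟨?_⟩, ?_, ?_, ?_⟩
  · exact ((Homotopy.refl _).add hom).trans (Homotopy.ofEq (add_zero _))
  · obtain ⟨a, rfl⟩ := Nat.exists_eq_succ_of_ne_zero (by omega : i ≠ 0)
    rw [HomologicalComplex.add_f_apply, hval a (a + 1) (a + 2) rfl rfl, H_eq,
      H_ne (a + 1) a (by omega)]
    simp
  · rw [HomologicalComplex.add_f_apply, hval i (i + 1) (i + 2) rfl rfl, H_eq,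
      H_ne (i + 2) (i + 1) (by omega)]
    simp
  · intro j hj hj'
    rw [HomologicalComplex.add_f_apply]
    obtain _ | a := j
    · rw [Homotopy.nullHomotopicMap_f_of_not_rel_right (c := ComplexShape.up ℕ) (k₁ := 0) (k₀ := 1)
        (by simp) (by simp) H, H_ne 1 0 (by omega)]
      simp
    · rw [hval a (a + 1) (a + 2) rfl rfl, H_ne (a + 2) (a + 1) (by omega),
        H_ne (a + 1) a (by omega)]
      simp

end EndedComplex

variable [HasFiniteBiproducts 𝒞]

/-- `X` is a direct sum of `m` objects with local endomorphism rings. -/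
def HasLocalDecomposition (X : 𝒞) (m : ℕ) : Prop :=
  ∃ (J : Type) (_ : Fintype J) (Y : J → 𝒞), (∀ j, IsLocalRing (End (Y j))) ∧
    Nonempty (SumData Y X) ∧ Fintype.card J = m

/-- The least number of summands in a decomposition of `X` into objects with local endomorphism
rings. -/
def numSummands (X : 𝒞) : ℕ := sInf {m | HasLocalDecomposition X m}

theorem numSummands_le {X : 𝒞} {m : ℕ} (h : HasLocalDecomposition X m) : numSummands X ≤ m :=
  Nat.sInf_le h

theorem IsKrullSchmidt.hasLocalDecomposition (hKS : IsKrullSchmidt 𝒞) (X : 𝒞) :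
    HasLocalDecomposition X (numSummands X) := by
  obtain ⟨m, Y, hY, hD⟩ := hKS.exists_sumData X
  exact Nat.sInf_mem (s := {m | HasLocalDecomposition X m}) ⟨m, _, _, Y, hY, hD, by simp⟩

namespace SumData

variable {J : Type} [Fintype J] {Y : J → 𝒞} {X : 𝒞}

theorem hasLocalDecomposition_compl [DecidableEq J] (hY : ∀ j, IsLocalRing (End (Y j))) (a : J) :
    HasLocalDecomposition (⨁ fun j : {j // j ≠ a} => Y j) (Fintype.card J - 1) :=
  ⟨{j // j ≠ a}, inferInstance, fun j => Y j, fun j => hY j, ⟨ofIso (Iso.refl _)⟩, by simp⟩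

theorem sum_compl_eq [DecidableEq J] {W : 𝒞} (a : J) (f : J → (X ⟶ W)) (ha : f a = 0) :
    ∑ j : {j // j ≠ a}, f j = ∑ j, f j := by
  rw [← Finset.add_sum_erase Finset.univ f (Finset.mem_univ a), ha, zero_add]
  exact (Finset.sum_subtype _ (by simp) f).symm

/-- If `p` is a retraction of the inclusion of a summand, then the other summands form a
complement of the image of the idempotent `p ≫ ι a`. -/
theorem exists_splitting_of_retraction (D : SumData Y X) (hY : ∀ j, IsLocalRing (End (Y j)))
    (a : J) (p : X ⟶ Y a) (hp : D.ι a ≫ p = 𝟙 _) :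
    ∃ (Z : 𝒞) (r : X ⟶ Z) (s : Z ⟶ X), s ≫ r = 𝟙 Z ∧ r ≫ s = 𝟙 X - p ≫ D.ι a ∧
      HasLocalDecomposition Z (Fintype.card J - 1) := by
  classical
  refine ⟨⨁ fun j : {j // j ≠ a} => Y j, biproduct.lift fun j => D.π j,
    biproduct.desc fun j => D.ι j ≫ (𝟙 X - p ≫ D.ι a), ?_, ?_, hasLocalDecomposition_compl hY a⟩
  · refine biproduct.hom_ext' _ _ fun j => biproduct.hom_ext _ _ fun l => ?_
    by_cases h : j = l
    · subst h
      simp [D.ι_π_ne _ _ j.2.symm, Preadditive.comp_sub, Preadditive.sub_comp]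
    · simp [D.ι_π_ne _ _ (fun h' => h (Subtype.ext h')), D.ι_π_ne _ _ l.2.symm,
        Preadditive.comp_sub, Preadditive.sub_comp, biproduct.ι_π_ne _ h]
  · rw [biproduct.lift_desc]
    have h0 : D.ι a ≫ (𝟙 X - p ≫ D.ι a) = 0 := by
      rw [Preadditive.comp_sub, ← Category.assoc, hp]
      simp
    refine (sum_compl_eq a (fun j => D.π j ≫ D.ι j ≫ (𝟙 X - p ≫ D.ι a)) ?_).trans (D.total_comp _)
    rw [h0, comp_zero]

/-- If `q` is a section of the projection onto a summand, then the other summands form a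
complement of the image of the idempotent `π a ≫ q`. -/
theorem exists_splitting_of_section (D : SumData Y X) (hY : ∀ j, IsLocalRing (End (Y j)))
    (a : J) (q : Y a ⟶ X) (hq : q ≫ D.π a = 𝟙 _) :
    ∃ (Z : 𝒞) (r : X ⟶ Z) (s : Z ⟶ X), s ≫ r = 𝟙 Z ∧ r ≫ s = 𝟙 X - D.π a ≫ q ∧
      HasLocalDecomposition Z (Fintype.card J - 1) := by
  classical
  refine ⟨⨁ fun j : {j // j ≠ a} => Y j, biproduct.lift fun j => (𝟙 X - D.π a ≫ q) ≫ D.π j,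
    biproduct.desc fun j => D.ι j, ?_, ?_, hasLocalDecomposition_compl hY a⟩
  · refine biproduct.hom_ext' _ _ fun j => biproduct.hom_ext _ _ fun l => ?_
    have h1 : D.ι j.1 ≫ D.π a ≫ q = 0 := by
      rw [← Category.assoc, D.ι_π_ne _ _ j.2, zero_comp]
    by_cases h : j = l
    · subst h
      simp [reassoc_of% h1, Preadditive.comp_sub, Preadditive.sub_comp]
    · simp [D.ι_π_ne _ _ (fun h' => h (Subtype.ext h')), reassoc_of% h1,
        Preadditive.comp_sub, Preadditive.sub_comp, biproduct.ι_π_ne _ h]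
  · rw [biproduct.lift_desc]
    have h0 : (𝟙 X - D.π a ≫ q) ≫ D.π a = 0 := by
      rw [Preadditive.sub_comp, Category.assoc, hq]
      simp
    refine (sum_compl_eq a (fun j => ((𝟙 X - D.π a ≫ q) ≫ D.π j) ≫ D.ι j) ?_).trans
      (D.comp_total _)
    rw [h0, zero_comp]

end SumData

/-- The number of indecomposable summands of the terms of a complex. -/
def EndedComplex.size {n : ℕ} {A C : 𝒞} (X : EndedComplex n A C) : ℕ :=
  ∑ j ∈ Finset.range (n + 2), numSummands (X.cx.X j)

/-- A complex with a non-radical differential between inner terms is homotopy equivalent to a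
smaller one: an isomorphism between indecomposable summands splits off. -/
theorem EndedComplex.exists_size_lt (hKS : IsKrullSchmidt 𝒞) {n : ℕ} {A C : 𝒞}
    (X : EndedComplex n A C) (i : ℕ) (hi : 1 ≤ i) (hin : i < n)
    (hd : ¬InRadical (X.cx.d i (i + 1))) :
    ∃ X' : EndedComplex n A C, HtpyEquiv X X' ∧ X'.size < X.size := by
  obtain ⟨J, _, Y, hY, ⟨D⟩, hJ⟩ := hKS.hasLocalDecomposition (X.cx.X i)
  obtain ⟨K, _, Z, hZ, ⟨F⟩, hK⟩ := hKS.hasLocalDecomposition (X.cx.X (i + 1))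
  obtain ⟨a, b, hab⟩ := exists_isIso_component D F hY hZ _ hd
  let t := inv (D.ι a ≫ X.cx.d i (i + 1) ≫ F.π b)
  -- The resulting endomorphism is the idempotent whose image omits the two isomorphic summands.
  obtain ⟨f, ⟨hf⟩, hfi, hfi', hfj⟩ := X.exists_homotopy_id i hi (-(F.π b ≫ t ≫ D.ι a))
  have hJ0 : 0 < Fintype.card J := Fintype.card_pos_iff.2 ⟨a⟩
  have hK0 : 0 < Fintype.card K := Fintype.card_pos_iff.2 ⟨b⟩
  have hsplit : ∀ j, ∃ (Z : 𝒞) (r : X.cx.X j ⟶ Z) (s : Z ⟶ X.cx.X j), s ≫ r = 𝟙 Z ∧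
      r ≫ s = f.f j ∧ numSummands Z ≤ numSummands (X.cx.X j) ∧
      (j = i → numSummands Z < numSummands (X.cx.X j)) := by
    intro j
    by_cases hji : j = i
    · subst hji
      obtain ⟨Z, r, s, h₁, h₂, h₃⟩ := D.exists_splitting_of_retraction hY a
        (X.cx.d j (j + 1) ≫ F.π b ≫ t) (by simp [t, ← Category.assoc])
      have hlt : numSummands Z < numSummands (X.cx.X j) := by
        have := numSummands_le h₃
        omega
      exact ⟨Z, r, s, h₁, by rw [h₂, hfi]; simp [sub_eq_add_neg], hlt.le, fun _ => hlt⟩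
    by_cases hji' : j = i + 1
    · subst hji'
      obtain ⟨Z, r, s, h₁, h₂, h₃⟩ := F.exists_splitting_of_section hZ b
        (t ≫ D.ι a ≫ X.cx.d i (i + 1)) (by simp [t])
      exact ⟨Z, r, s, h₁, by rw [h₂, hfi']; simp [sub_eq_add_neg],
        by have := numSummands_le h₃; omega, fun h => absurd h (by omega)⟩
    · exact ⟨_, 𝟙 _, 𝟙 _, by simp, by rw [hfj j hji hji']; simp, le_rfl, fun h => absurd h hji⟩
  choose Z r s hsr hrs hle hlt using hsplit
  obtain ⟨X', hX', hX'Z⟩ := X.exists_htpyEquiv_of_splitting f hf (hfj 0 (by omega) (by omega))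
    (hfj (n + 1) (by omega) (by omega)) Z r s hsr hrs
  refine ⟨X', hX', ?_⟩
  simp only [size, hX'Z]
  exact Finset.sum_lt_sum (fun j _ => hle j) ⟨i, by simp; omega, hlt i rfl⟩

/-- In a Krull–Schmidt category every complex is homotopy equivalent to one with radical inner
differentials. -/
theorem EndedComplex.exists_radical (hKS : IsKrullSchmidt 𝒞) {n : ℕ} {A C : 𝒞}
    (X : EndedComplex n A C) :
    ∃ X' : EndedComplex n A C, HtpyEquiv X X' ∧
      ∀ i, 1 ≤ i → i < n → InRadical (X'.cx.d i (i + 1)) := by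
  induction hN : X.size using Nat.strong_induction_on generalizing X with
  | _ N ih =>
    by_cases h : ∀ i, 1 ≤ i → i < n → InRadical (X.cx.d i (i + 1))
    · exact ⟨X, (htpySetoid n A C).refl X, h⟩
    · push Not at h
      obtain ⟨i, hi, hin, hd⟩ := h
      obtain ⟨X₁, h₁, hlt⟩ := X.exists_size_lt hKS i hi hin hd
      obtain ⟨X₂, h₂, hr⟩ := ih _ (hN ▸ hlt) X₁ rfl
      exact ⟨X₂, (htpySetoid n A C).trans h₁ h₂, hr⟩

end Minimal

/-! ### Almost split extensions -/

section AlmostSplit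

variable {k : Type u} [CommRing k] {𝒞 : Type uC} [Category.{v} 𝒞] [Preadditive 𝒞]
variable {E : 𝒞ᵒᵖ ⥤ 𝒞 ⥤ ModuleCat.{w} k}

/-- A nonzero extension which is annihilated by all morphisms that are not split epimorphisms,
respectively split monomorphisms. -/
structure IsAlmostSplit {A C : 𝒞} (δ : Ext E C A) : Prop where
  ne_zero : δ ≠ 0
  pull_eq_zero : ∀ (W : 𝒞) (g : W ⟶ C), ¬IsSplitEpi g → pull E g A δ = 0
  push_eq_zero : ∀ (W : 𝒞) (f : A ⟶ W), ¬IsSplitMono f → push E C f δ = 0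

theorem not_isSplitEpi_of_pull_eq_zero {A C W : 𝒞} {μ : Ext E C A} (hμ : μ ≠ 0) {g : W ⟶ C}
    (hg : pull E g A μ = 0) : ¬IsSplitEpi g := fun _ => hμ <| by
  rw [← pull_id_apply C A μ, ← IsSplitEpi.id g, pull_comp_apply, hg, map_zero]

theorem not_isSplitMono_of_push_eq_zero {A C W : 𝒞} {μ : Ext E C A} (hμ : μ ≠ 0) {f : A ⟶ W}
    (hf : push E C f μ = 0) : ¬IsSplitMono f := fun _ => hμ <| by
  rw [← push_id_apply C A μ, ← IsSplitMono.id f, push_comp_apply, hf, map_zero]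

variable [Linear k 𝒞] [HasFiniteBiproducts 𝒞] [IsBilinear E] {n : ℕ} {S : NExangulated E n}

theorem IsARExangle.isAlmostSplit {A C : 𝒞} {X : EndedComplex n A C} {δ : Ext E C A}
    (h : IsARExangle S X δ) : IsAlmostSplit δ where
  ne_zero := by
    rintro rfl
    obtain ⟨s, hs⟩ := (S.isNExangle _ _ h.realizes).exact_left_last C (𝟙 C) (map_zero _)
    exact h.right.1 ⟨⟨⟨s, hs⟩⟩⟩
  pull_eq_zero W g hg := by
    obtain ⟨t, rfl⟩ := h.right.2 W g hg
    rw [pull_comp_apply, (S.isNExangle _ _ h.realizes).pull_dLast, map_zero]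
  push_eq_zero W f hf := by
    obtain ⟨t, rfl⟩ := h.left.2 W f hf
    rw [push_comp_apply, (S.isNExangle _ _ h.realizes).push_dFirst, map_zero]

/-- An almost split extension is realized by an Auslander–Reiten `n`-exangle, namely by any
realization with radical inner differentials. -/
theorem IsAlmostSplit.exists_isARExangle (hKS : IsKrullSchmidt 𝒞) (S : NExangulated E n)
    {A C : 𝒞} {δ : Ext E C A} (h : IsAlmostSplit δ) :
    ∃ X : EndedComplex n A C, IsARExangle S X δ := by
  obtain ⟨X₀, hX₀⟩ := S.exists_realizes δ
  obtain ⟨X, hX, hrad⟩ := X₀.exists_radical hKS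
  have hR : Realizes S.s δ X := Eq.trans hX₀ (Quotient.sound hX)
  have hN := S.isNExangle _ _ hR
  exact ⟨X, hR,
    ⟨not_isSplitMono_of_push_eq_zero h.ne_zero hN.push_dFirst,
      fun W f hf => hN.exact_right_first W f (h.push_eq_zero W f hf)⟩,
    ⟨not_isSplitEpi_of_pull_eq_zero h.ne_zero hN.pull_dLast,
      fun W g hg => hN.exact_left_last W g (h.pull_eq_zero W g hg)⟩, hrad⟩

end AlmostSplit

/-! ### Dualizing functionals -/

section Dualizing

variable {k : Type u} [CommRing k] {𝒞 : Type uC} [Category.{v} 𝒞] [Preadditive 𝒞]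
variable {E : 𝒞ᵒᵖ ⥤ 𝒞 ⥤ ModuleCat.{w} k} {I : Type u} [AddCommGroup I] [Module k I]

/-- A functional `φ` on `𝔼(X, T)` is dualizing if it induces isomorphisms
`(𝒞/ℐ)(Y, T) ≅ D 𝔼(X, Y)` and `(𝒞/𝒫)(X, Z) ≅ D 𝔼(Z, T)` by pushforward and pullback. -/
structure IsDualizing {X T : 𝒞} (φ : Ext E X T →ₗ[k] I) : Prop where
  exists_push : ∀ (Y : 𝒞) (ψ : Ext E X Y →ₗ[k] I), ∃ t : Y ⟶ T, φ ∘ₗ push E X t = ψ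
  injTrivial : ∀ (Y : 𝒞) (t : Y ⟶ T), φ ∘ₗ push E X t = 0 → InjTrivial E t
  exists_pull : ∀ (Z : 𝒞) (ψ : Ext E Z T →ₗ[k] I), ∃ x : X ⟶ Z, φ ∘ₗ pull E x T = ψ
  projTrivial : ∀ (Z : 𝒞) (x : X ⟶ Z), φ ∘ₗ pull E x T = 0 → ProjTrivial E x

theorem InjTrivial.comp_right {A B C : 𝒞} {f : A ⟶ B} (hf : InjTrivial E f) (g : B ⟶ C) :
    InjTrivial E (f ≫ g) := fun Z => by
  rw [push_comp, hf Z, LinearMap.comp_zero]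

theorem InjTrivial.comp_left {A B C : 𝒞} {f : B ⟶ C} (hf : InjTrivial E f) (g : A ⟶ B) :
    InjTrivial E (g ≫ f) := fun Z => by
  rw [push_comp, hf Z, LinearMap.zero_comp]

theorem ProjTrivial.comp_right {A B C : 𝒞} {f : A ⟶ B} (hf : ProjTrivial E f) (g : B ⟶ C) :
    ProjTrivial E (f ≫ g) := fun Z => by
  rw [pull_comp, hf Z, LinearMap.zero_comp]

theorem ProjTrivial.comp_left {A B C : 𝒞} {f : B ⟶ C} (hf : ProjTrivial E f) (g : A ⟶ B) :
    ProjTrivial E (g ≫ f) := fun Z => by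
  rw [pull_comp, hf Z, LinearMap.comp_zero]

theorem isDualizing_zero {X T : 𝒞} (hX : IsProjObj E X) (hT : IsInjObj E T) :
    IsDualizing (0 : Ext E X T →ₗ[k] I) where
  exists_push Y ψ := ⟨0, by
    ext x
    have : x = 0 := by rw [← pull_id_apply X Y x, hX Y]; rfl
    simp [this]⟩
  injTrivial Y t _ := by simpa using hT.comp_left t
  exists_pull Z ψ := ⟨0, by
    ext x
    have : x = 0 := by rw [← push_id_apply Z T x, hT Z]; rfl
    simp [this]⟩
  projTrivial Z x _ := by simpa using hX.comp_right x

variable [Linear k 𝒞] [IsBilinear E]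

theorem InjTrivial.sum {A B : 𝒞} {J : Type*} (s : Finset J) {f : J → (A ⟶ B)}
    (hf : ∀ j ∈ s, InjTrivial E (f j)) : InjTrivial E (∑ j ∈ s, f j) := fun Z => by
  ext x
  rw [push_sum_apply]
  exact Finset.sum_eq_zero fun j hj => by rw [hf j hj Z]; rfl

theorem ProjTrivial.sum {A B : 𝒞} {J : Type*} (s : Finset J) {f : J → (A ⟶ B)}
    (hf : ∀ j ∈ s, ProjTrivial E (f j)) : ProjTrivial E (∑ j ∈ s, f j) := fun Z => by
  ext x
  rw [pull_sum_apply]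
  exact Finset.sum_eq_zero fun j hj => by rw [hf j hj Z]; rfl

/-- Dualizing functionals are compatible with finite direct sums. -/
theorem exists_isDualizing_of_sumData {J : Type} [Fintype J] {Y U : J → 𝒞} {X T : 𝒞}
    (D : SumData Y X) (F : SumData U T) (φ : ∀ j, Ext E (Y j) (U j) →ₗ[k] I)
    (hφ : ∀ j, IsDualizing (φ j)) : ∃ φ' : Ext E X T →ₗ[k] I, IsDualizing φ' := by
  classical
  let φ' : Ext E X T →ₗ[k] I := ∑ j, φ j ∘ₗ push E (Y j) (F.π j) ∘ₗ pull E (D.ι j) T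
  have hφ' : ∀ x, φ' x = ∑ j, φ j (push E (Y j) (F.π j) (pull E (D.ι j) T x)) := fun x => by
    simp [φ']
  have hpush : ∀ {Z : 𝒞} (t : Z ⟶ T) (x : Ext E X Z), φ' (push E X t x) =
      ∑ j, φ j (push E (Y j) (t ≫ F.π j) (pull E (D.ι j) Z x)) := fun t x => by
    simp only [hφ', pull_push_apply, push_comp_apply]
  have hpull : ∀ {Z : 𝒞} (z : X ⟶ Z) (x : Ext E Z T), φ' (pull E z T x) =
      ∑ j, φ j (pull E (D.ι j ≫ z) (U j) (push E Z (F.π j) x)) := fun z x => by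
    simp only [hφ', pull_push_apply, pull_comp_apply]
  refine ⟨φ', ⟨fun Z ψ => ?_, fun Z t ht => ?_, fun Z ψ => ?_, fun Z z hz => ?_⟩⟩
  · choose t ht using fun j => (hφ j).exists_push Z (ψ ∘ₗ pull E (D.π j) Z)
    refine ⟨∑ j, t j ≫ F.ι j, ?_⟩
    ext x
    rw [LinearMap.comp_apply, hpush]
    have : ∀ j, φ j (push E (Y j) (t j) (pull E (D.ι j) Z x)) =
        ψ (pull E (D.π j ≫ D.ι j) Z x) := fun j => by
      rw [pull_comp_apply]
      exact LinearMap.congr_fun (ht j) _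
    simp only [F.sum_comp_π, this]
    rw [← map_sum, ← pull_sum_apply, D.total, pull_id_apply]
  · have h : ∀ j, InjTrivial E (t ≫ F.π j) := fun j => by
      refine (hφ j).injTrivial _ _ ?_
      ext x
      have h1 := LinearMap.congr_fun ht (pull E (D.π j) Z x)
      rw [LinearMap.comp_apply, hpush, Finset.sum_eq_single j] at h1
      · rwa [← pull_comp_apply, D.ι_π_self, pull_id_apply] at h1
      · intro i _ hij
        rw [← pull_comp_apply, D.ι_π_ne _ _ hij]
        simp
      · simp
    rw [← F.comp_total t]
    exact InjTrivial.sum _ fun j _ => (h j).comp_right _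
  · choose z hz using fun j => (hφ j).exists_pull Z (ψ ∘ₗ push E Z (F.ι j))
    refine ⟨∑ j, D.π j ≫ z j, ?_⟩
    ext x
    rw [LinearMap.comp_apply, hpull]
    have : ∀ j, φ j (pull E (z j) (U j) (push E Z (F.π j) x)) =
        ψ (push E Z (F.π j ≫ F.ι j) x) := fun j => by
      rw [push_comp_apply]
      exact LinearMap.congr_fun (hz j) _
    simp only [D.ι_comp_sum, this]
    rw [← map_sum, ← push_sum_apply, F.total, push_id_apply]
  · have h : ∀ j, ProjTrivial E (D.ι j ≫ z) := fun j => by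
      refine (hφ j).projTrivial _ _ ?_
      ext x
      have h1 := LinearMap.congr_fun hz (push E Z (F.ι j) x)
      rw [LinearMap.comp_apply, hpull, Finset.sum_eq_single j] at h1
      · rwa [← push_comp_apply, F.ι_π_self, push_id_apply] at h1
      · intro i _ hij
        rw [← push_comp_apply, F.ι_π_ne _ _ hij.symm]
        simp
      · simp
    rw [← D.total_comp z]
    exact ProjTrivial.sum _ fun j _ => (h j).comp_left _

variable [HasFiniteBiproducts 𝒞] {n : ℕ}

/-- A functional which does not vanish on an almost split extension `δ` is dualizing: every
nonzero extension starting or ending at the same object can be moved to `δ`, so that the pairings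
are nondegenerate, and nondegenerate pairings with modules of finite length are perfect. -/
theorem IsAlmostSplit.exists_isDualizing [IsArtinianRing k]
    (hI : IsMinimalInjectiveCogenerator k I) (hE : IsExtFinite E) (S : NExangulated E n)
    (hn : 1 ≤ n) {A C : 𝒞} {δ : Ext E C A} (h : IsAlmostSplit δ) :
    ∃ φ : Ext E C A →ₗ[k] I, IsDualizing φ := by
  obtain ⟨φ, hφ⟩ := hI.exists_apply_ne_zero h.ne_zero
  have hpush : ∀ {Y : 𝒞} (μ : Ext E C Y), μ ≠ 0 → ∃ t : Y ⟶ A, push E C t μ = δ := fun μ hμ =>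
    S.exists_push_eq μ δ fun W g hg => h.pull_eq_zero W g (not_isSplitEpi_of_pull_eq_zero hμ hg)
  have hpull : ∀ {Z : 𝒞} (μ : Ext E Z A), μ ≠ 0 → ∃ x : C ⟶ Z, pull E x A μ = δ := fun μ hμ =>
    S.exists_pull_eq hn μ δ fun W f hf =>
      h.push_eq_zero W f (not_isSplitMono_of_push_eq_zero hμ hf)
  refine ⟨φ, ⟨fun Y ψ => ?_, fun Y t ht Z => ?_, fun Z ψ => ?_, fun Z x hx Y => ?_⟩⟩
  · have := hE C Y
    have htop := hI.eq_top_of_separates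
      (LinearMap.range (LinearMap.compRight k φ ∘ₗ pushHom E Y A C)) fun μ hμ => by
        by_contra hne
        obtain ⟨t, ht⟩ := hpush μ hne
        refine hφ ?_
        rw [← ht]
        exact hμ _ ⟨t, rfl⟩
    exact LinearMap.range_eq_top.1 htop ψ
  · ext ν
    by_contra hne
    obtain ⟨x, hx⟩ := hpull _ hne
    refine hφ ?_
    rw [← hx, pull_push_apply]
    exact LinearMap.congr_fun ht _
  · have := hE Z A
    have htop := hI.eq_top_of_separates
      (LinearMap.range (LinearMap.compRight k φ ∘ₗ pullHom E C Z A)) fun μ hμ => by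
        by_contra hne
        obtain ⟨x, hx⟩ := hpull μ hne
        refine hφ ?_
        rw [← hx]
        exact hμ _ ⟨x, rfl⟩
    exact LinearMap.range_eq_top.1 htop ψ
  · ext ν
    by_contra hne
    obtain ⟨t, ht⟩ := hpush _ hne
    refine hφ ?_
    rw [← ht, ← pull_push_apply]
    exact LinearMap.congr_fun hx _

theorem isInjObj_of_isZero {Z : 𝒞} (hZ : IsZero Z) : IsInjObj E Z := fun W => by
  ext x
  rw [hZ.eq_of_src (𝟙 Z) 0, push_zero_apply]
  rfl

theorem isProjObj_of_isZero {Z : 𝒞} (hZ : IsZero Z) : IsProjObj E Z := fun W => by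
  ext x
  rw [hZ.eq_of_src (𝟙 Z) 0, pull_zero_apply]
  rfl

theorem HasRightARExangles.exists_isDualizing [IsArtinianRing k]
    (hI : IsMinimalInjectiveCogenerator k I) (hE : IsExtFinite E) (hKS : IsKrullSchmidt 𝒞)
    {S : NExangulated E n} (hn : 1 ≤ n) (hS : HasRightARExangles S) (X : 𝒞) :
    ∃ (T : 𝒞) (φ : Ext E X T →ₗ[k] I), IsDualizing φ := by
  obtain ⟨m, Y, hY, ⟨D⟩⟩ := hKS.exists_sumData X
  have h : ∀ j, ∃ (T : 𝒞) (φ : Ext E (Y j) T →ₗ[k] I), IsDualizing φ := fun j => by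
    by_cases hj : IsProjObj E (Y j)
    · exact ⟨0, 0, isDualizing_zero hj (isInjObj_of_isZero (isZero_zero 𝒞))⟩
    · have := hY j
      obtain ⟨A, _, δ, hδ⟩ := hS (Y j) (indecomposable_of_isLocalRing _) hj
      exact ⟨A, hδ.isAlmostSplit.exists_isDualizing hI hE S hn⟩
  choose T φ hφ using h
  exact ⟨(⨁ T), exists_isDualizing_of_sumData D (SumData.ofIso (Iso.refl (⨁ T))) φ hφ⟩

theorem HasLeftARExangles.exists_isDualizing [IsArtinianRing k]
    (hI : IsMinimalInjectiveCogenerator k I) (hE : IsExtFinite E) (hKS : IsKrullSchmidt 𝒞)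
    {S : NExangulated E n} (hn : 1 ≤ n) (hS : HasLeftARExangles S) (T : 𝒞) :
    ∃ (X : 𝒞) (φ : Ext E X T →ₗ[k] I), IsDualizing φ := by
  obtain ⟨m, Y, hY, ⟨D⟩⟩ := hKS.exists_sumData T
  have h : ∀ j, ∃ (X : 𝒞) (φ : Ext E X (Y j) →ₗ[k] I), IsDualizing φ := fun j => by
    by_cases hj : IsInjObj E (Y j)
    · exact ⟨0, 0, isDualizing_zero (isProjObj_of_isZero (isZero_zero 𝒞)) hj⟩
    · have := hY j
      obtain ⟨C, _, δ, hδ⟩ := hS (Y j) (indecomposable_of_isLocalRing _) hj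
      exact ⟨C, hδ.isAlmostSplit.exists_isDualizing hI hE S hn⟩
  choose X φ hφ using h
  exact ⟨(⨁ X), exists_isDualizing_of_sumData (SumData.ofIso (Iso.refl (⨁ X))) D φ hφ⟩

end Dualizing

/-! ### The Auslander–Reiten translation -/

section Translation

variable {k : Type u} [CommRing k] {𝒞 : Type uC} [Category.{v} 𝒞] [Preadditive 𝒞]
  [Linear k 𝒞] {E : 𝒞ᵒᵖ ⥤ 𝒞 ⥤ ModuleCat.{w} k} [IsBilinear E]
  {I : Type u} [AddCommGroup I] [Module k I]

theorem toCostable_map_eq_iff {A B : 𝒞} (f g : A ⟶ B) :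
    (toCostable E).map f = (toCostable E).map g ↔ InjTrivial E (f - g) :=
  CategoryTheory.Quotient.functor_map_eq_iff (injRel E) f g

theorem toStable_map_eq_iff {A B : 𝒞} (f g : A ⟶ B) :
    (toStable E).map f = (toStable E).map g ↔ ProjTrivial E (f - g) :=
  CategoryTheory.Quotient.functor_map_eq_iff (projRel E) f g

theorem toCostable_map_smul (r : k) {A B : 𝒞} (f : A ⟶ B) :
    (toCostable E).map (r • f) = r • (toCostable E).map f := rfl

theorem toStable_map_smul (r : k) {A B : 𝒞} (f : A ⟶ B) :
    (toStable E).map (r • f) = r • (toStable E).map f := rfl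

theorem InjTrivial.comp_push_eq {X T Y : 𝒞} (φ : Ext E X T →ₗ[k] I) {s t : Y ⟶ T}
    (h : InjTrivial E (s - t)) : φ ∘ₗ push E X s = φ ∘ₗ push E X t := by
  rw [(injRel_iff E s t).1 h]

namespace IsDualizing

variable {X T : 𝒞} {φ : Ext E X T →ₗ[k] I}

theorem toCostable_map_eq (hφ : IsDualizing φ) {Y : 𝒞} {s t : Y ⟶ T}
    (h : φ ∘ₗ push E X s = φ ∘ₗ push E X t) : (toCostable E).map s = (toCostable E).map t := by
  rw [toCostable_map_eq_iff]
  refine hφ.injTrivial _ _ ?_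
  have := (LinearMap.compRight k φ ∘ₗ pushHom E Y T X).map_sub s t
  exact this.trans (sub_eq_zero.2 h)

theorem projTrivial_sub (hφ : IsDualizing φ) {Z : 𝒞} {x y : X ⟶ Z}
    (h : φ ∘ₗ pull E x T = φ ∘ₗ pull E y T) : ProjTrivial E (x - y) := by
  refine hφ.projTrivial _ _ ?_
  have := (LinearMap.compRight k φ ∘ₗ pullHom E X Z T).map_sub x y
  exact this.trans (sub_eq_zero.2 h)

/-- A morphism `t : Y ⟶ T` representing the functional `ψ`; it is unique in the costable
category. -/
def rep (hφ : IsDualizing φ) {Y : 𝒞} (ψ : Ext E X Y →ₗ[k] I) : Y ⟶ T :=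
  (hφ.exists_push Y ψ).choose

theorem rep_spec (hφ : IsDualizing φ) {Y : 𝒞} (ψ : Ext E X Y →ₗ[k] I) :
    φ ∘ₗ push E X (hφ.rep ψ) = ψ := (hφ.exists_push Y ψ).choose_spec

theorem rep_apply (hφ : IsDualizing φ) {Y : 𝒞} (ψ : Ext E X Y →ₗ[k] I) (x : Ext E X Y) :
    φ (push E X (hφ.rep ψ) x) = ψ x := LinearMap.congr_fun (hφ.rep_spec ψ) x

/-- The isomorphism `D 𝔼(X, Y) ≅ (𝒞/ℐ)(Y, T)` inverse to pushing the dualizing functional. -/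
def repEquiv (hφ : IsDualizing φ) (Y : 𝒞) :
    (Ext E X Y →ₗ[k] I) ≃ₗ[k] ((toCostable E).obj Y ⟶ (toCostable E).obj T) :=
  LinearEquiv.ofBijective
    { toFun := fun ψ => (toCostable E).map (hφ.rep ψ)
      map_add' := fun ψ ψ' => by
        rw [← Functor.map_add]
        refine hφ.toCostable_map_eq ?_
        ext x
        simp [rep_apply, push_add_apply]
      map_smul' := fun r ψ => by
        rw [RingHom.id_apply, ← toCostable_map_smul]
        refine hφ.toCostable_map_eq ?_
        rw [rep_spec, IsBilinear.push_smul, LinearMap.comp_smul, rep_spec] }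
    ⟨fun ψ ψ' h => by
        have := ((toCostable_map_eq_iff _ _).1 h).comp_push_eq φ
        rwa [rep_spec, rep_spec] at this,
      fun f => by
        obtain ⟨t, rfl⟩ := (toCostable E).map_surjective f
        exact ⟨φ ∘ₗ push E X t, hφ.toCostable_map_eq (rep_spec _ _)⟩⟩

/-- Two objects with dualizing functionals on extensions of the same object are isomorphic in the
costable category. -/
theorem nonempty_iso (hφ : IsDualizing φ) {T' : 𝒞} {φ' : Ext E X T' →ₗ[k] I}
    (hφ' : IsDualizing φ') : Nonempty ((toCostable E).obj T ≅ (toCostable E).obj T') := by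
  refine ⟨⟨(toCostable E).map (hφ'.rep φ), (toCostable E).map (hφ.rep φ'), ?_, ?_⟩⟩
  · rw [← Functor.map_comp]
    refine (hφ.toCostable_map_eq (t := 𝟙 T) ?_).trans ((toCostable E).map_id T)
    ext x
    simp [push_comp_apply, rep_apply]
  · rw [← Functor.map_comp]
    refine (hφ'.toCostable_map_eq (t := 𝟙 T') ?_).trans ((toCostable E).map_id T')
    ext x
    simp [push_comp_apply, rep_apply]

end IsDualizing

variable {T : 𝒞 → 𝒞} {φ : ∀ X, Ext E X (T X) →ₗ[k] I}

/-- The translate `T X ⟶ T X'` of `x : X ⟶ X'` is characterized in the costable category by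
`φ X' ∘ (tauMap x)_* = φ X ∘ x^*`. -/
def tauMap (hφ : ∀ X, IsDualizing (φ X)) {X X' : 𝒞} (x : X ⟶ X') : T X ⟶ T X' :=
  (hφ X').rep (φ X ∘ₗ pull E x (T X))

theorem tauMap_apply (hφ : ∀ X, IsDualizing (φ X)) {X X' : 𝒞} (x : X ⟶ X')
    (e : Ext E X' (T X)) : φ X' (push E X' (tauMap hφ x) e) = φ X (pull E x (T X) e) :=
  (hφ X').rep_apply _ e

/-- The translation `𝒞/𝒫 ⥤ 𝒞/ℐ` defined by a choice of dualizing functionals. -/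
def tau (hφ : ∀ X, IsDualizing (φ X)) : Stable E ⥤ Costable E :=
  CategoryTheory.Quotient.lift (projRel E)
    { obj := fun X => (toCostable E).obj (T X)
      map := fun x => (toCostable E).map (tauMap hφ x)
      map_id := fun X => by
        refine ((hφ X).toCostable_map_eq (t := 𝟙 (T X)) ?_).trans ((toCostable E).map_id (T X))
        ext e
        simp [tauMap_apply]
      map_comp := fun {X Y Z} x y => by
        rw [← Functor.map_comp]
        refine (hφ Z).toCostable_map_eq ?_
        ext e
        simp only [LinearMap.comp_apply, push_comp_apply, tauMap_apply, pull_push_apply,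
          pull_comp_apply] }
    fun X Y x y h => (hφ Y).toCostable_map_eq <| by
      ext e
      simp only [LinearMap.comp_apply, tauMap_apply, (projRel_iff E x y).1 h]

instance (hφ : ∀ X, IsDualizing (φ X)) : (tau hφ).Additive where
  map_add {X Y f g} := by
    obtain ⟨X⟩ := X
    obtain ⟨Y⟩ := Y
    obtain ⟨f, rfl⟩ := (toStable E).map_surjective f
    obtain ⟨g, rfl⟩ := (toStable E).map_surjective g
    rw [← Functor.map_add]
    refine ((hφ Y).toCostable_map_eq (t := tauMap hφ f + tauMap hφ g) ?_).trans
      ((toCostable E).map_add)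
    ext e
    simp [tauMap_apply, push_add_apply, pull_add_apply]

instance (hφ : ∀ X, IsDualizing (φ X)) : Functor.Linear k (tau hφ) where
  map_smul {X Y} f r := by
    obtain ⟨X⟩ := X
    obtain ⟨Y⟩ := Y
    obtain ⟨f, rfl⟩ := (toStable E).map_surjective f
    rw [← toStable_map_smul]
    refine ((hφ Y).toCostable_map_eq (t := r • tauMap hφ f) ?_).trans
      (toCostable_map_smul r (tauMap hφ f))
    ext e
    simp [tauMap_apply, IsBilinear.push_smul, IsBilinear.pull_smul]

instance (hφ : ∀ X, IsDualizing (φ X)) : (tau hφ).Full where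
  map_surjective {X Y} t := by
    obtain ⟨X⟩ := X
    obtain ⟨Y⟩ := Y
    obtain ⟨t, rfl⟩ := (toCostable E).map_surjective (X := T X) (Y := T Y) t
    obtain ⟨x, hx⟩ := (hφ X).exists_pull Y (φ Y ∘ₗ push E Y t)
    refine ⟨(toStable E).map x, (hφ Y).toCostable_map_eq ?_⟩
    rw [← hx]
    exact (hφ Y).rep_spec _

instance (hφ : ∀ X, IsDualizing (φ X)) : (tau hφ).Faithful where
  map_injective {X Y} f g h := by
    obtain ⟨X⟩ := X
    obtain ⟨Y⟩ := Y
    obtain ⟨f, rfl⟩ := (toStable E).map_surjective f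
    obtain ⟨g, rfl⟩ := (toStable E).map_surjective g
    have h := (toCostable_map_eq_iff (tauMap hφ f) (tauMap hφ g)).1 h
    refine (toStable_map_eq_iff _ _).2 ((hφ X).projTrivial_sub ?_)
    ext e
    simp only [LinearMap.comp_apply, ← tauMap_apply hφ]
    exact LinearMap.congr_fun (h.comp_push_eq (φ Y)) e

theorem hasARSDuality_of_isDualizing (hφ : ∀ X, IsDualizing (φ X))
    (hleft : ∀ A : 𝒞, ∃ (X : 𝒞) (ψ : Ext E X A →ₗ[k] I), IsDualizing ψ) : HasARSDuality E I := by
  have hess : (tau hφ).EssSurj := ⟨fun A => by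
    obtain ⟨A⟩ := A
    obtain ⟨X, ψ, hψ⟩ := hleft A
    exact ⟨(toStable E).obj X, (hφ X).nonempty_iso hψ⟩⟩
  refine ⟨tau hφ, {}, inferInstance, inferInstance, fun X Y => (hφ X).repEquiv Y, ?_⟩
  intro X X' Y Y' x y ψ
  refine ((hφ X').toCostable_map_eq (t := y ≫ (hφ X).rep ψ ≫ tauMap hφ x) ?_).trans
    (((toCostable E).map_comp _ _).trans
      (congrArg ((toCostable E).map y ≫ ·) ((toCostable E).map_comp _ _)))
  ext e
  simp only [LinearMap.comp_apply, push_comp_apply, IsDualizing.rep_apply, tauMap_apply,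
    pull_push_apply]

end Translation

/-! ### Almost split extensions from Auslander–Reiten–Serre duality -/

section OfDuality

section Reflect

variable {𝒞 : Type uC} [Category.{v} 𝒞] [Preadditive 𝒞] {𝒟 : Type*} [Category* 𝒟]
  [Preadditive 𝒟] (F : 𝒞 ⥤ 𝒟) [F.Additive] [F.Full]

/-- An endomorphism sent to the identity is invertible, as the kernel of `F` on a local
endomorphism ring is a proper ideal. -/
theorem isIso_of_map_eq_id {X : 𝒞} [IsLocalRing (End X)] (h0 : 𝟙 (F.obj X) ≠ 0) (f : X ⟶ X)
    (hf : F.map f = 𝟙 _) : IsIso f := by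
  refine (isIso_or_isIso_of_add (show f + (𝟙 X - f) = 𝟙 X by abel)).resolve_right fun h => h0 ?_
  have h1 : F.map (𝟙 X - f) = 0 := by simp [hf]
  rw [← F.map_id, ← IsIso.hom_inv_id (𝟙 X - f), F.map_comp, h1, zero_comp]

theorem isSplitMono_of_map {X Y : 𝒞} [IsLocalRing (End X)] (h0 : 𝟙 (F.obj X) ≠ 0) (f : X ⟶ Y)
    (hf : IsSplitMono (F.map f)) : IsSplitMono f := by
  obtain ⟨s, hs⟩ := F.map_surjective (retraction (F.map f))
  have := isIso_of_map_eq_id F h0 (f ≫ s) (by rw [F.map_comp, hs, IsSplitMono.id])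
  exact ⟨⟨⟨s ≫ inv (f ≫ s), by rw [← Category.assoc, IsIso.hom_inv_id]⟩⟩⟩

theorem isSplitEpi_of_map {X Y : 𝒞} [IsLocalRing (End Y)] (h0 : 𝟙 (F.obj Y) ≠ 0) (f : X ⟶ Y)
    (hf : IsSplitEpi (F.map f)) : IsSplitEpi f := by
  obtain ⟨s, hs⟩ := F.map_surjective (section_ (F.map f))
  have := isIso_of_map_eq_id F h0 (s ≫ f) (by rw [F.map_comp, hs, IsSplitEpi.id])
  exact ⟨⟨⟨inv (s ≫ f) ≫ s, by rw [Category.assoc, IsIso.inv_hom_id]⟩⟩⟩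

end Reflect

variable {k : Type u} [CommRing k] {𝒞 : Type uC} [Category.{v} 𝒞] [Preadditive 𝒞]
  [Linear k 𝒞] {E : 𝒞ᵒᵖ ⥤ 𝒞 ⥤ ModuleCat.{w} k} [IsBilinear E]
  {I : Type u} [AddCommGroup I] [Module k I]

theorem toCostable_id_ne_zero_iff (A : 𝒞) :
    𝟙 ((toCostable E).obj A) ≠ 0 ↔ ¬IsInjObj E A := by
  rw [← (toCostable E).map_id, ← (toCostable E).map_zero, Ne, toCostable_map_eq_iff, sub_zero]
  rfl

theorem toStable_id_ne_zero_iff (A : 𝒞) : 𝟙 ((toStable E).obj A) ≠ 0 ↔ ¬IsProjObj E A := by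
  rw [← (toStable E).map_id, ← (toStable E).map_zero, Ne, toStable_map_eq_iff, sub_zero]
  rfl

/-- If `τ C ≅ A`, then `D 𝔼(C, A)` is isomorphic to the local ring `(𝒞/ℐ)(A, A)`, and an extension
annihilated by all functionals in the radical of this ring is almost split. -/
theorem exists_isAlmostSplit [IsArtinianRing k] (hI : IsMinimalInjectiveCogenerator k I)
    (hE : IsExtFinite E) (τ : Stable E ⥤ Costable E) [τ.IsEquivalence]
    (Φ : ∀ X Y : 𝒞,
      (Ext E X Y →ₗ[k] I) ≃ₗ[k] ((toCostable E).obj Y ⟶ τ.obj ((toStable E).obj X)))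
    (hΦ : ∀ {X X' Y Y' : 𝒞} (x : X ⟶ X') (y : Y' ⟶ Y) (φ : Ext E X Y →ₗ[k] I),
      Φ X' Y' (φ ∘ₗ pull E x Y ∘ₗ push E X' y) =
        (toCostable E).map y ≫ Φ X Y φ ≫ τ.map ((toStable E).map x))
    {A C : 𝒞} [IsLocalRing (End A)] [IsLocalRing (End C)] (hA : ¬IsInjObj E A)
    (hC : ¬IsProjObj E C) (e : (toCostable E).obj A ≅ τ.obj ((toStable E).obj C)) :
    ∃ δ : Ext E C A, IsAlmostSplit δ := by
  have hA0 := (toCostable_id_ne_zero_iff (E := E) A).2 hA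
  have hC0 := (toStable_id_ne_zero_iff (E := E) C).2 hC
  have := isLocalRing_end_map (toCostable E) A hA0
  -- The functionals which correspond to non-isomorphisms `A ⟶ τ C` in the costable category.
  let N : Submodule k (Ext E C A →ₗ[k] I) :=
    { carrier := {φ | ¬IsIso (Φ C A φ)}
      zero_mem' := fun h => hA0 <| by
        rw [map_zero] at h
        rw [← IsIso.hom_inv_id (0 : (toCostable E).obj A ⟶ τ.obj ((toStable E).obj C)), zero_comp]
      add_mem' := fun {φ ψ} hφ hψ h => by
        rw [map_add] at h
        rcases isIso_or_isIso_of_add (f := Φ C A φ ≫ inv (Φ C A φ + Φ C A ψ))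
          (g := Φ C A ψ ≫ inv (Φ C A φ + Φ C A ψ))
          (by rw [← Preadditive.add_comp, IsIso.hom_inv_id]) with h' | h'
        · exact hφ (IsIso.of_isIso_comp_right _ (inv (Φ C A φ + Φ C A ψ)))
        · exact hψ (IsIso.of_isIso_comp_right _ (inv (Φ C A φ + Φ C A ψ)))
      smul_mem' := fun r φ hφ h => by
        rw [map_smul] at h
        have h₁ := IsIso.hom_inv_id (r • Φ C A φ)
        have h₂ := IsIso.inv_hom_id (r • Φ C A φ)
        rw [Linear.smul_comp, ← Linear.comp_smul] at h₁
        rw [Linear.comp_smul, ← Linear.smul_comp] at h₂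
        exact hφ ⟨_, h₁, h₂⟩ }
  have hN : N ≠ ⊤ := fun h => by
    have : (Φ C A).symm e.hom ∈ N := h ▸ Submodule.mem_top
    refine this ?_
    rw [LinearEquiv.apply_symm_apply]
    infer_instance
  have := hE C A
  obtain ⟨δ, hδN, hδ⟩ : ∃ δ : Ext E C A, (∀ φ ∈ N, φ δ = 0) ∧ δ ≠ 0 := by
    by_contra! h
    exact hN (hI.eq_top_of_separates N h)
  refine ⟨δ, hδ, fun W g hg => ?_, fun W f hf => ?_⟩
  · by_contra hne
    obtain ⟨φ, hφ⟩ := hI.exists_apply_ne_zero hne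
    refine hφ (hδN (φ ∘ₗ pull E g A) fun (h : IsIso _) => hg ?_)
    have h1 := hΦ g (𝟙 A) φ
    have h2 : φ ∘ₗ pull E g A ∘ₗ push E C (𝟙 A) = φ ∘ₗ pull E g A := by ext x; simp
    rw [h2, (toCostable E).map_id, Category.id_comp] at h1
    rw [h1] at h
    refine isSplitEpi_of_map (toStable E) hC0 g ?_
    have : IsSplitEpi (τ.map ((toStable E).map g)) :=
      ⟨⟨⟨inv (Φ W A φ ≫ τ.map ((toStable E).map g)) ≫ Φ W A φ, by simp⟩⟩⟩
    exact (τ.isSplitEpi_iff _).1 this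
  · by_contra hne
    obtain ⟨φ, hφ⟩ := hI.exists_apply_ne_zero hne
    refine hφ (hδN (φ ∘ₗ push E C f) fun (h : IsIso _) => hf ?_)
    have h1 := hΦ (𝟙 C) f φ
    have h2 : φ ∘ₗ pull E (𝟙 C) W ∘ₗ push E C f = φ ∘ₗ push E C f := by ext x; simp
    rw [h2, (toStable E).map_id, τ.map_id, Category.comp_id] at h1
    rw [h1] at h
    refine isSplitMono_of_map (toCostable E) hA0 f ?_
    exact ⟨⟨⟨Φ C W φ ≫ inv ((toCostable E).map f ≫ Φ C W φ), by
      rw [← Category.assoc, IsIso.hom_inv_id]⟩⟩⟩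

variable [HasFiniteBiproducts 𝒞] {n : ℕ}

theorem hasARExangles_of_hasARSDuality [IsArtinianRing k]
    (hI : IsMinimalInjectiveCogenerator k I) (hE : IsExtFinite E) (hKS : IsKrullSchmidt 𝒞)
    (S : NExangulated E n) (h : HasARSDuality E I) : HasARExangles S := by
  obtain ⟨τ, _, _, _, Φ, hΦ⟩ := h
  refine ⟨fun C hC hCp => ?_, fun A hA hAi => ?_⟩
  · have := hKS.isLocalRing_end hC
    have hC0 := (toStable_id_ne_zero_iff (E := E) C).2 hCp
    have := isLocalRing_end_map (toStable E) C hC0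
    obtain ⟨T, hT⟩ : ∃ T, (toCostable E).obj T = τ.obj ((toStable E).obj C) := ⟨_, rfl⟩
    have hτ : IsLocalRing (End ((toCostable E).obj T)) := by
      rw [hT]
      refine isLocalRing_end_map τ _ fun h0 => hC0 (τ.map_injective ?_)
      rw [τ.map_id, h0, τ.map_zero]
    obtain ⟨m, Y, hY, ⟨D⟩⟩ := hKS.exists_sumData T
    obtain ⟨j, ⟨e⟩⟩ := D.exists_iso_map (toCostable E)
    have := hY j
    have := isLocalRing_end_of_iso e.symm
    obtain ⟨δ, hδ⟩ := exists_isAlmostSplit hI hE τ Φ hΦ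
      ((toCostable_id_ne_zero_iff (Y j)).1 (id_ne_zero_of_isLocalRing _)) hCp
      (e ≪≫ eqToIso hT)
    obtain ⟨X, hX⟩ := hδ.exists_isARExangle hKS S
    exact ⟨_, X, δ, hX⟩
  · have := hKS.isLocalRing_end hA
    have hA0 := (toCostable_id_ne_zero_iff (E := E) A).2 hAi
    have := isLocalRing_end_map (toCostable E) A hA0
    obtain ⟨T, hT⟩ : ∃ T, (toStable E).obj T = τ.objPreimage ((toCostable E).obj A) := ⟨_, rfl⟩
    let e₀ : τ.obj ((toStable E).obj T) ≅ (toCostable E).obj A :=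
      τ.mapIso (eqToIso hT) ≪≫ τ.objObjPreimageIso _
    have hτ : IsLocalRing (End ((toStable E).obj T)) := by
      have hloc := isLocalRing_end_of_iso e₀.symm
      refine isLocalRing_end (fun h0 => id_ne_zero_of_isLocalRing (τ.obj ((toStable E).obj T)) ?_)
        fun f g hfg => ?_
      · rw [← τ.map_id, h0, τ.map_zero]
      · rcases isIso_or_isIso_of_add (f := τ.map f) (g := τ.map g)
          (by rw [← τ.map_add, hfg, τ.map_id]) with h | h
        · exact Or.inl (isIso_of_reflects_iso f τ)
        · exact Or.inr (isIso_of_reflects_iso g τ)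
    obtain ⟨m, Y, hY, ⟨D⟩⟩ := hKS.exists_sumData T
    obtain ⟨j, ⟨e⟩⟩ := D.exists_iso_map (toStable E)
    have := hY j
    have := isLocalRing_end_of_iso e.symm
    obtain ⟨δ, hδ⟩ := exists_isAlmostSplit hI hE τ Φ hΦ hAi
      ((toStable_id_ne_zero_iff (Y j)).1 (id_ne_zero_of_isLocalRing _)) (τ.mapIso e ≪≫ e₀).symm
    obtain ⟨X, hX⟩ := hδ.exists_isARExangle hKS S
    exact ⟨_, X, δ, hX⟩

end OfDuality

end NExang

end

theorem theorem3p5 {k : Type u} [CommRing k] [IsArtinianRing k]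
    (I : Type u) [AddCommGroup I] [Module k I] (hI : NExang.IsMinimalInjectiveCogenerator k I)
    {𝒞 : Type uC} [Category.{v} 𝒞] [Preadditive 𝒞] [Linear k 𝒞] [HasFiniteBiproducts 𝒞]
    (E : 𝒞ᵒᵖ ⥤ 𝒞 ⥤ ModuleCat.{w} k) [NExang.IsBilinear E] (n : ℕ) (hn : 1 ≤ n)
    (S : NExang.NExangulated E n) (hKS : NExang.IsKrullSchmidt 𝒞) (hE : NExang.IsExtFinite E) :
    NExang.HasARExangles S ↔ NExang.HasARSDuality E I := by
  refine ⟨fun h => ?_, NExang.hasARExangles_of_hasARSDuality hI hE hKS S⟩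
  choose T φ hφ using h.1.exists_isDualizing hI hE hKS hn
  exact NExang.hasARSDuality_of_isDualizing hφ (h.2.exists_isDualizing hI hE hKS hn)
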